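/- Let $M$ be a Lorentzian manifold of dimension $d\ge 2$ (signature $(-,+,\dots,+)$), and let $U\subset M$ be open and geodesically convex, i.e. for every $x\in U$ the exponential map $\exp_x$ maps some star-shaped open neighbourhood of $0\in T_xM$ diffeomorphically onto $U$. Let $P$ be a normally hyperbolic operator on the bundle $E=U\times\mathbb{C}^r$, i.e. a linear second order differential operator with smooth coefficients whose principal symbol is minus the metric times the identity, so that locally $P=-g^{ij}\partial_i\partial_j+A^i\partial_i+C$. Let $\nabla$ be the connection on $E$ induced by $P$, i.e. the one for which $P=\square^\nabla+B$ with a bundle endomorphism $B$; here $\square^\nabla=-\operatorname{tr}_g(\nabla\nabla)$, and $\square=-\operatorname{div}\operatorname{grad}$ on functions. For $x\in U$ put $\Gamma_x(y)=-g_x(\exp_x^{-1}(y),\exp_x^{-1}(y))$ and $$\rho_x V=\nabla_{\operatorname{grad}\Gamma_x}V-\left(\tfrac12\square\Gamma_x-d\right)V .$$ The Hadamard coefficients of $P$ at $x$ are the smooth sections $V^k_x$ ($k\in\mathbb{N}=\{0,1,2,\dots\}$) of $E\otimes E_x^*$ over $U$ determined by $V^0_x(x)=1$ and the transport equations $$(\rho_x-2k)V^k_x=2k\,P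 V^{k-1}_x\qquad\text{on }U,$$ with right-hand side $0$ for $k=0$. Then for every $x\in U$ and $z\in\mathbb{C}$ the Hadamard coefficients $V^k_x(z)$ of the shifted operator $P-z$ are $$V^k_x(z)=\sum_{m=0}^k\binom{k}{m}z^m\,V^{k-m}_x\qquad(k\in\mathbb{N}).$$ That is, if $(V^k_x)_k$ is the family of Hadamard coefficients of $P$ at $x$, then a family $(W^k)_k$ satisfies the conditions defining the Hadamard coefficients of $P-z$ at $x$ if and only if $W^k=\sum_{m=0}^k\binom{k}{m}z^mV^{k-m}_x$ on $U$ for all $k$. -/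

import Mathlib

open scoped Manifold ContDiff

noncomputable section

/-! ### Lorentzian metrics -/

/-- The model space of a `d`-dimensional manifold. In Mathlib every tangent space
`TangentSpace (𝓡 d) p` of such a manifold is (definitionally) this vector space. -/
abbrev Model (d : ℕ) := EuclideanSpace ℝ (Fin d)

/-- The `i`-th coordinate vector field of the chart `φ`, at the point `φ⁻¹(a)`. -/
def coordVec {d : ℕ} {M : Type*} [TopologicalSpace M] [ChartedSpace (Model d) M]
    (φ : OpenPartialHomeomorph M (Model d)) (a : Model d) (i : Fin d) :
    TangentSpace (𝓡 d) (φ.symm a) :=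
  mfderiv (𝓡 d) (𝓡 d) φ.symm a (EuclideanSpace.single i (1 : ℝ))

/-- The `i`-th partial derivative of a function on the model space. -/
def pderiv {d : ℕ} {F : Type*} [NormedAddCommGroup F] [NormedSpace ℝ F]
    (i : Fin d) (f : Model d → F) (a : Model d) : F :=
  fderiv ℝ f a (EuclideanSpace.single i (1 : ℝ))

/-- A smooth Lorentzian metric, of signature `(-, +, …, +)`. -/
structure LorentzianMetric (d : ℕ) (M : Type*) [TopologicalSpace M]
    [ChartedSpace (Model d) M] where
  /-- the bilinear form on each tangent space -/
  val : ∀ p : M, TangentSpace (𝓡 d) p →L[ℝ] TangentSpace (𝓡 d) p →L[ℝ] ℝ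
  symm : ∀ p v w, val p v w = val p w v
  /-- there is a timelike vector on whose orthogonal complement the form is positive definite -/
  signature : ∀ p, ∃ v, val p v v < 0 ∧ ∀ w, w ≠ 0 → val p v w = 0 → 0 < val p w w
  /-- the components of the metric in every chart are smooth -/
  smooth : ∀ φ ∈ atlas (Model d) M, ∀ i j : Fin d,
    ContDiffOn ℝ ∞ (fun a => val (φ.symm a) (coordVec φ a i) (coordVec φ a j)) φ.target

namespace LorentzianMetric

variable {d : ℕ} {M : Type*} [TopologicalSpace M] [ChartedSpace (Model d) M]
  (g : LorentzianMetric d M)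

/-- The matrix `(g_ij)` of the metric in the chart `φ`, as a function on the chart image. -/
def gram (φ : OpenPartialHomeomorph M (Model d)) (a : Model d) : Matrix (Fin d) (Fin d) ℝ :=
  Matrix.of fun i j => g.val (φ.symm a) (coordVec φ a i) (coordVec φ a j)

/-- The inverse matrix `(g^ij)`. -/
def gramInv (φ : OpenPartialHomeomorph M (Model d)) (a : Model d) : Matrix (Fin d) (Fin d) ℝ :=
  (g.gram φ a)⁻¹

/-- The Christoffel symbols `Γ^k_ij` of the Levi-Civita connection in the chart `φ`. -/
def christoffel (φ : OpenPartialHomeomorph M (Model d)) (k i j : Fin d) (a : Model d) : ℝ :=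
  (1 / 2 : ℝ) * ∑ l, g.gramInv φ a k l *
    (pderiv i (fun b => g.gram φ b j l) a + pderiv j (fun b => g.gram φ b i l) a
      - pderiv l (fun b => g.gram φ b i j) a)

/-! ### Geodesics, exponential map, convexity -/

/-- `c` is a smooth curve on `s` (an open set of parameters) and satisfies the geodesic equation
at each time of `s`, written in the preferred chart at the current point. -/
def IsGeodesicOn (c : ℝ → M) (s : Set ℝ) : Prop :=
  ContMDiffOn 𝓘(ℝ, ℝ) (𝓡 d) ∞ c s ∧
  ∀ t ∈ s, ∀ k : Fin d,
    let φ := chartAt (Model d) (c t)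
    let γ : ℝ → Model d := fun τ => φ (c τ)
    deriv (deriv γ) t k
      + ∑ i, ∑ j, g.christoffel φ k i j (γ t) * deriv γ t i * deriv γ t j = 0

/-- `e`, restricted to the star-shaped open neighbourhood `Ω` of `0` in `T_x M`, is the exponential
map at `x` (i.e. `t ↦ e (t v)` is the geodesic with initial velocity `v`, for every `v ∈ Ω`), and
it is a diffeomorphism from `Ω` onto `U`, with inverse `l`. -/
structure IsExpDiffeo (U : Set M) (x : M) (Ω : Set (Model d)) (e : Model d → M)
    (l : M → Model d) : Prop where
  isOpen : IsOpen Ω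
  zero_mem : (0 : Model d) ∈ Ω
  starConvex : StarConvex ℝ 0 Ω
  geodesic : ∀ v ∈ Ω, g.IsGeodesicOn (fun t : ℝ => e (t • v)) {t : ℝ | t • v ∈ Ω}
  velocity : ∀ v ∈ Ω, tangentMap 𝓘(ℝ, ℝ) (𝓡 d) (fun t : ℝ => e (t • v))
    (⟨0, (1 : ℝ)⟩ : TangentBundle 𝓘(ℝ, ℝ) ℝ) = (⟨x, v⟩ : TangentBundle (𝓡 d) M)
  mapsTo : Set.MapsTo e Ω U
  mapsTo_inv : Set.MapsTo l U Ω
  left_inv : ∀ v ∈ Ω, l (e v) = v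
  right_inv : ∀ y ∈ U, e (l y) = y
  smooth : ContMDiffOn (𝓡 d) (𝓡 d) ∞ e Ω
  smooth_inv : ContMDiffOn (𝓡 d) (𝓡 d) ∞ l U

/-- `U` is open and geodesically convex: it is geodesically star-shaped with respect to each of
its points `x`, i.e. the exponential map at `x` maps some star-shaped open neighbourhood of
`0 ∈ T_x M` diffeomorphically onto `U`. -/
def IsGeodesicallyConvex (U : Set M) : Prop :=
  IsOpen U ∧ ∀ x ∈ U, ∃ Ω e l, g.IsExpDiffeo U x Ω e l

/-- The inverse `exp_x⁻¹ : U → T_x M` of the exponential map of the convex set `U`. -/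
def invExp (U : Set M) (x : M) : M → Model d :=
  Classical.epsilon fun l => ∃ Ω e, g.IsExpDiffeo U x Ω e l

/-- The Lorentzian squared geodesic distance
`Γ_x(y) = - g_x (exp_x⁻¹ y, exp_x⁻¹ y)` on the convex set `U`. -/
def sqDist (U : Set M) (x : M) (y : M) : ℝ :=
  - g.val x (g.invExp U x y) (g.invExp U x y)

/-- The d'Alembertian `□ f = - div grad f = - g^ij (∂_i ∂_j f - Γ^k_ij ∂_k f)` of a real function,
computed at `y` in the preferred chart at `y`. -/
def dAlembert (f : M → ℝ) (y : M) : ℝ :=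
  let φ := chartAt (Model d) y;
  let F : Model d → ℝ := fun a => f (φ.symm a);
  - ∑ i, ∑ j, g.gramInv φ (φ y) i j *
      (pderiv i (pderiv j F) (φ y) - ∑ k, g.christoffel φ k i j (φ y) * pderiv k F (φ y))

end LorentzianMetric

/-! ### Connections and normally hyperbolic operators on the trivial bundle `U × ℂ^r` -/

/-- The typical fibre `ℂ^r`. -/
abbrev Fiber (r : ℕ) := Fin r → ℂ

/-- The endomorphisms of the typical fibre. -/
abbrev EndFiber (r : ℕ) := Fiber r →L[ℂ] Fiber r

/-- Smooth sections of the trivial bundle `U × ℂ^r` (values outside of `U` are irrelevant). -/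
def IsSmoothSection {d r : ℕ} {M : Type*} [TopologicalSpace M] [ChartedSpace (Model d) M]
    (U : Set M) (u : M → Fiber r) : Prop :=
  ContMDiffOn (𝓡 d) 𝓘(ℝ, Fiber r) ∞ u U

/-- A smooth connection `∇ = d + ω` on the trivial bundle `U × ℂ^r`, given by its
`End(ℂ^r)`-valued connection one-form `ω`. -/
structure BundleConnection (d r : ℕ) (M : Type*) [TopologicalSpace M]
    [ChartedSpace (Model d) M] (U : Set M) where
  /-- the connection one-form -/
  form : ∀ p : M, TangentSpace (𝓡 d) p →L[ℝ] EndFiber r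
  smooth : ∀ φ ∈ atlas (Model d) M, ∀ i : Fin d,
    ContDiffOn ℝ ∞ (fun a => form (φ.symm a) (coordVec φ a i)) (φ.target ∩ φ.symm ⁻¹' U)

namespace BundleConnection

variable {d r : ℕ} {M : Type*} [TopologicalSpace M] [ChartedSpace (Model d) M] {U : Set M}
  (D : BundleConnection d r M U)

/-- The covariant derivative `∇_i f = ∂_i f + ω_i f` along the `i`-th coordinate vector field of
the chart `φ`, for a section `f` expressed as a function on the chart image. -/
def coordDeriv (φ : OpenPartialHomeomorph M (Model d)) (i : Fin d) (f : Model d → Fiber r)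
    (a : Model d) : Fiber r :=
  pderiv i f a + D.form (φ.symm a) (coordVec φ a i) (f a)

/-- The connection d'Alembertian
`□^∇ u = - tr_g (∇ ∇ u) = - g^ij (∇_i ∇_j u - Γ^k_ij ∇_k u)`, computed at `y` in the preferred
chart at `y`. -/
def dAlembert (g : LorentzianMetric d M) (u : M → Fiber r) (y : M) : Fiber r :=
  let φ := chartAt (Model d) y;
  let f : Model d → Fiber r := fun a => u (φ.symm a);
  - ∑ i, ∑ j, g.gramInv φ (φ y) i j •
      (D.coordDeriv φ i (D.coordDeriv φ j f) (φ y)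
        - ∑ k, g.christoffel φ k i j (φ y) • D.coordDeriv φ k f (φ y))

/-- The derivative `∇_{grad h} u = g^ij (∂_j h) ∇_i u` of the section `u` along the gradient of
the function `h`, computed at `y` in the preferred chart at `y`. -/
def gradDeriv (g : LorentzianMetric d M) (h : M → ℝ) (u : M → Fiber r) (y : M) : Fiber r :=
  let φ := chartAt (Model d) y
  ∑ i, ∑ j, (g.gramInv φ (φ y) i j * pderiv j (fun a => h (φ.symm a)) (φ y)) •
    D.coordDeriv φ i (fun a => u (φ.symm a)) (φ y)

end BundleConnection

section Operators

variable {d r : ℕ} {M : Type*} [TopologicalSpace M] [ChartedSpace (Model d) M]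

/-- `P` is a normally hyperbolic operator on the bundle `U × ℂ^r`: a linear differential operator
of second order with smooth coefficients and with principal symbol `-g` times the identity; in
every chart, `P u = - g^ij ∂_i ∂_j u + A^i ∂_i u + C u` for smooth matrix-valued functions
`A^i`, `C`. -/
def IsNormallyHyperbolic (g : LorentzianMetric d M) (U : Set M)
    (P : (M → Fiber r) → M → Fiber r) : Prop :=
  ∀ φ ∈ atlas (Model d) M, ∃ (A : Fin d → Model d → EndFiber r) (C : Model d → EndFiber r),
    (∀ i, ContDiffOn ℝ ∞ (A i) (φ.target ∩ φ.symm ⁻¹' U)) ∧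
    ContDiffOn ℝ ∞ C (φ.target ∩ φ.symm ⁻¹' U) ∧
    ∀ u : M → Fiber r, IsSmoothSection (d := d) U u → ∀ a ∈ φ.target ∩ φ.symm ⁻¹' U,
      let f : Model d → Fiber r := fun b => u (φ.symm b)
      P u (φ.symm a) =
        - ∑ i, ∑ j, g.gramInv φ a i j • pderiv i (pderiv j f) a
          + ∑ i, A i a (pderiv i f a) + C a (f a)

/-- `D` is the connection induced by `P`, i.e. `P = □^D + B` on `U` for some smooth bundle
endomorphism `B`. -/
def IsInducedConnection (g : LorentzianMetric d M) (U : Set M)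
    (P : (M → Fiber r) → M → Fiber r) (D : BundleConnection d r M U) : Prop :=
  ∃ B : M → EndFiber r, ContMDiffOn (𝓡 d) 𝓘(ℝ, EndFiber r) ∞ B U ∧
    ∀ u : M → Fiber r, IsSmoothSection (d := d) U u →
      ∀ y ∈ U, P u y = D.dAlembert g u y + B y (u y)

/-- The shifted operator `P - z`. -/
def shiftOp (P : (M → Fiber r) → M → Fiber r) (z : ℂ) : (M → Fiber r) → M → Fiber r :=
  fun u y => P u y - z • u y

/-- `ρ_x u = ∇_{grad Γ_x} u - (½ □ Γ_x - d) u`. -/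
def rho (g : LorentzianMetric d M) (U : Set M) (D : BundleConnection d r M U) (x : M)
    (u : M → Fiber r) (y : M) : Fiber r :=
  D.gradDeriv g (g.sqDist U x) u y
    - ((1 / 2 : ℝ) * g.dAlembert (g.sqDist U x) y - (d : ℝ)) • u y

/-- `V = (V^k_x)_k` is the family of Hadamard coefficients of `P` on `U` with base point `x`:
smooth sections of `E ⊗ E_x^*` over `U`, i.e. functions with values in `End(ℂ^r)`, such that
`V^0_x(x) = 1` and the transport equations `(ρ_x - 2k) V^k_x = 2k P V^{k-1}_x` hold on `U`
(with right-hand side `0` for `k = 0`), where `ρ_x` is formed with the connection induced by `P`.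
The operators act on the factor `E` only, i.e. on the sections `y ↦ V^k_x(y) ξ` of `E`, for
each `ξ ∈ E_x`. -/
def IsHadamardFamily (g : LorentzianMetric d M) (U : Set M)
    (P : (M → Fiber r) → M → Fiber r) (x : M) (V : ℕ → M → EndFiber r) : Prop :=
  ∃ D : BundleConnection d r M U, IsInducedConnection g U P D ∧
    (∀ k, ContMDiffOn (𝓡 d) 𝓘(ℝ, EndFiber r) ∞ (V k) U) ∧
    V 0 x = ContinuousLinearMap.id ℂ (Fiber r) ∧
    (∀ ξ : Fiber r, ∀ y ∈ U, rho g U D x (fun p => V 0 p ξ) y = 0) ∧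
    (∀ k : ℕ, ∀ ξ : Fiber r, ∀ y ∈ U,
      rho g U D x (fun p => V (k + 1) p ξ) y - (2 * ((k : ℂ) + 1)) • V (k + 1) y ξ =
        (2 * ((k : ℂ) + 1)) • P (fun p => V k p ξ) y)

end Operators

end

/-! Existence and uniqueness are separate, and uniqueness is the hard part.

Existence: subtracting `z` changes only the endomorphism `B`, so `P - z` induces the same connection
and the same operator ρ_x. Inserting the binomial combination into the transport equations leaves an
identity between binomial sums (`sum_choose_transport`): Pascal's rule produces the extra term `-z`,
and (k+1-m)·C(k+1,m) = (k+1)·C(k,m) turns the differing factors 2(k+1-m) into the common factor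
2(k+1).

Uniqueness: Leibniz' rule gives ρ_x = ½[Γ_x, P] + d (`rho_eq_commutator`). Hence ρ_x is linear and
local on smooth sections and does not depend on which induced connection is chosen. In normal
coordinates the Gauss lemma identifies grad Γ_x with -2 times the radial field, so ρ_x becomes -2
w·∂_w + K(w) with K smooth (`exists_rho_eq`). The existence of V⁰ with V⁰(x) = 1 forces K(0) = 0.
Thus along the ray t ↦ t v the homogeneous equation (ρ_x - 2k)u = 0 reads t X' = (½K(t v) - k)X with
K(t v) = O(t). Multiplying by t^k and applying Gronwall's inequality shows that a solution regular
at 0 vanishes, provided X(0) = 0 when k = 0. Induction on k then gives at most one Hadamard family.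

The Gauss lemma is derived from the geodesic equation by pulling the metric back along the
exponential map: there the rays are geodesics, and only first derivatives of the pulled back form
remain. -/

noncomputable section

open Set Filter Topology

/-! ### The Gauss lemma for a field of bilinear forms -/

/-- The Gauss lemma in normal coordinates: if the rays through the origin satisfy the geodesic
equation of the symmetric bilinear form field `G`, then `G v v b = G 0 v b`. -/
theorem gauss_lemma_of_geodesic_rays {E : Type*} [NormedAddCommGroup E] [NormedSpace ℝ E]
    {Ω : Set E} (hΩ : IsOpen Ω) (hstar : StarConvex ℝ 0 Ω) (G : E → E →L[ℝ] E →L[ℝ] ℝ)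
    (hG : DifferentiableOn ℝ G Ω) (hsymm : ∀ w ∈ Ω, ∀ a b, G w a b = G w b a)
    (hgeo : ∀ v ∈ Ω, ∀ b, fderiv ℝ G v v v b = (1 / 2 : ℝ) * fderiv ℝ G v b v v)
    {v : E} (hv : v ∈ Ω) (b : E) : G v v b = G 0 v b := by
  have hmem : ∀ w ∈ Ω, ∀ t ∈ Icc (0 : ℝ) 1, t • w ∈ Ω := fun w hw t ht =>
    hstar.smul_mem hw ht.1 ht.2
  have hray : ∀ w ∈ Ω, ∀ t ∈ Icc (0 : ℝ) 1, ∀ a c : E,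
      HasDerivAt (fun s : ℝ => G (s • w) a c) (fderiv ℝ G (t • w) w a c) t := by
    intro w hw t ht a c
    have h1 : HasFDerivAt G (fderiv ℝ G (t • w)) (t • w) :=
      (hG.differentiableAt (hΩ.mem_nhds (hmem w hw t ht))).hasFDerivAt
    have h2 : HasDerivAt (fun s : ℝ => s • w) w t := by
      simpa using (hasDerivAt_id t).smul_const w
    have h3 := (h1.clm_apply (hasFDerivAt_const a _)).clm_apply (hasFDerivAt_const c _)
    have h4 := h3.comp_hasDerivAt t h2
    simp at h4
    exact h4
  have hnorm : ∀ w ∈ Ω, G w w w = G 0 w w := by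
    intro w hw
    obtain ⟨c, hc, hc'⟩ := exists_hasDerivAt_eq_slope (fun s : ℝ => G (s • w) w w)
      (fun s => fderiv ℝ G (s • w) w w w) one_pos
      (fun t ht => (hray w hw t ht w w).continuousAt.continuousWithinAt)
      (fun t ht => hray w hw t (Ioo_subset_Icc_self ht) w w)
    -- With `b` the radial vector itself, both sides of `hgeo` are multiples of the same number,
    -- with factors 1 and 1/2, so it vanishes: radial vectors keep constant length along the ray.
    have hk := hgeo (c • w) (hmem w hw c (Ioo_subset_Icc_self hc)) (c • w)
    simp only [map_smul, smul_apply, smul_eq_mul] at hk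
    have hc0 : c ≠ 0 := hc.1.ne'
    have hz : fderiv ℝ G (c • w) w w w = 0 := by
      have : c ^ 3 * fderiv ℝ G (c • w) w w w = 0 := by linarith
      simpa [hc0] using this
    rw [hz] at hc'
    simp at hc'
    linarith
  -- This is `hnorm` differentiated in the direction `b`.
  have hvar : ∀ w ∈ Ω, fderiv ℝ G w b w w + 2 * G w w b = 2 * G 0 w b := by
    intro w hw
    have h0 : (0 : E) ∈ Ω := by simpa using hmem v hv 0 (by simp)
    have h1 : HasFDerivAt G (fderiv ℝ G w) w :=
      (hG.differentiableAt (hΩ.mem_nhds hw)).hasFDerivAt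
    have h2 := (h1.clm_apply (hasFDerivAt_id w)).clm_apply (hasFDerivAt_id w)
    have h3 := ((hasFDerivAt_const (G 0) w).clm_apply (hasFDerivAt_id w)).clm_apply
      (hasFDerivAt_id w)
    have h4 : (fun w => G w (id w) (id w)) =ᶠ[𝓝 w] fun w => G 0 (id w) (id w) := by
      filter_upwards [hΩ.mem_nhds hw] with w' hw'
      exact hnorm w' hw'
    have h5 := congrArg (fun L => L b) (h2.unique (h3.congr_of_eventuallyEq h4))
    simp at h5
    rw [hsymm w hw b w, hsymm 0 h0 b w] at h5
    linarith
  -- The factor `s` makes the function vanish at 0 and matches the homogeneity of `hvar`: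
  -- eliminating the `b`-derivative between `hgeo` and `hvar` says exactly that its derivative is
  -- zero.
  obtain ⟨c, hc, hc'⟩ := exists_hasDerivAt_eq_slope (fun s : ℝ => s * (G (s • v) v b - G 0 v b))
      (fun s => 1 * (G (s • v) v b - G 0 v b) + s * fderiv ℝ G (s • v) v v b) one_pos
      (fun t ht => ((hasDerivAt_id t).mul
        ((hray v hv t ht v b).sub_const _)).continuousAt.continuousWithinAt)
      (fun t ht => (hasDerivAt_id t).mul
        ((hray v hv t (Ioo_subset_Icc_self ht) v b).sub_const _))
  have hm := hmem v hv c (Ioo_subset_Icc_self hc)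
  have hk := hgeo (c • v) hm b
  have hw := hvar (c • v) hm
  simp only [map_smul, smul_apply, smul_eq_mul] at hk hw
  have hc0 : c ≠ 0 := hc.1.ne'
  have hz : 1 * (G (c • v) v b - G 0 v b) + c * fderiv ℝ G (c • v) v v b = 0 := by
    have : c * (1 * (G (c • v) v b - G 0 v b) + c * fderiv ℝ G (c • v) v v b) = 0 := by
      linarith
    exact (mul_eq_zero.1 this).resolve_left hc0
  rw [hz] at hc'
  simp at hc'
  linarith

/-! ### A singular linear differential equation -/

/-- A solution of `t X' = (b(t) - k) X` with `b(t) = O(t)` that is regular at `0` (and vanishes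
there if `k = 0`) is zero. -/
theorem eq_zero_of_singular_ode {F : Type*} [NormedAddCommGroup F] [NormedSpace ℝ F]
    (k : ℕ) (X X' R : ℝ → F) (C : ℝ)
    (hX : ∀ t ∈ Icc (0 : ℝ) 1, HasDerivAt X (X' t) t)
    (hode : ∀ t ∈ Icc (0 : ℝ) 1, t • X' t = R t - (k : ℝ) • X t)
    (hR : ∀ t ∈ Icc (0 : ℝ) 1, ‖R t‖ ≤ C * t * ‖X t‖)
    (h0 : k = 0 → X 0 = 0) : X 1 = 0 := by
  -- The integrating factor t^k absorbs the term -kX: t Y' = t^k R, hence ‖Y'‖ ≤ C‖Y‖ away from 0.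
  set Y : ℝ → F := fun t => t ^ k • X t with hY
  set Y' : ℝ → F := fun t => t ^ k • X' t + ((k : ℝ) * t ^ (k - 1)) • X t with hY'
  have hYd : ∀ t ∈ Icc (0 : ℝ) 1, HasDerivAt Y (Y' t) t := fun t ht =>
    (hasDerivAt_pow k t).smul (hX t ht)
  have hYb : ∀ t ∈ Ioc (0 : ℝ) 1, ‖Y' t‖ ≤ C * ‖Y t‖ + 0 := by
    intro t ht
    have h1 : t • Y' t = t ^ k • R t := by
      have : R t = t • X' t + (k : ℝ) • X t := by
        rw [hode t (Ioc_subset_Icc_self ht)]; abel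
      rw [this, hY']
      rcases k with _ | k
      · simp
      · simp only [Nat.add_sub_cancel]
        module
    have h2 : t * ‖Y' t‖ = t ^ k * ‖R t‖ := by
      have := congrArg norm h1
      rwa [norm_smul, norm_smul, Real.norm_of_nonneg ht.1.le,
        Real.norm_of_nonneg (pow_nonneg ht.1.le k)] at this
    have h3 : ‖Y t‖ = t ^ k * ‖X t‖ := by
      rw [hY, norm_smul, Real.norm_of_nonneg (pow_nonneg ht.1.le k)]
    have h4 : t * ‖Y' t‖ ≤ t * (C * ‖Y t‖ + 0) := by
      rw [h2, h3]
      have := mul_le_mul_of_nonneg_left (hR t (Ioc_subset_Icc_self ht)) (pow_nonneg ht.1.le k)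
      calc t ^ k * ‖R t‖ ≤ t ^ k * (C * t * ‖X t‖) := this
        _ = _ := by ring
    exact le_of_mul_le_mul_left h4 ht.1
  -- The bound on Y' required division by t, so Gronwall starts at ε > 0; then ε → 0 and Y(0) = 0.
  have hbound : ∀ ε ∈ Ioc (0 : ℝ) 1, ‖Y 1‖ ≤ ‖Y ε‖ * Real.exp (C * (1 - ε)) := by
    intro ε hε
    have h := norm_le_gronwallBound_of_norm_deriv_right_le (f := Y) (f' := Y') (δ := ‖Y ε‖)
      (K := C) (ε := 0) (a := ε) (b := 1)
      (fun t ht => (hYd t ⟨hε.1.le.trans ht.1, ht.2⟩).continuousAt.continuousWithinAt)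
      (fun t ht => (hYd t ⟨hε.1.le.trans ht.1, ht.2.le⟩).hasDerivWithinAt) le_rfl
      (fun t ht => hYb t ⟨hε.1.trans_le ht.1, ht.2.le⟩) 1 ⟨hε.2, le_rfl⟩
    rwa [gronwallBound_ε0] at h
  have hY0 : Y 0 = 0 := by
    rcases k with _ | k
    · simp [hY, h0 rfl]
    · simp [hY]
  have hlim : Tendsto (fun ε => ‖Y ε‖ * Real.exp (C * (1 - ε))) (𝓝[>] 0) (𝓝 0) := by
    have hc : ContinuousAt (fun ε => ‖Y ε‖ * Real.exp (C * (1 - ε))) 0 :=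
      (hYd 0 (by simp)).continuousAt.norm.mul (by fun_prop)
    have := hc.tendsto
    simp only [hY0, norm_zero, zero_mul] at this
    exact this.mono_left nhdsWithin_le_nhds
  have hle : ‖Y 1‖ ≤ 0 := by
    refine ge_of_tendsto hlim ?_
    filter_upwards [Ioc_mem_nhdsGT one_pos] with ε hε
    exact hbound ε hε
  simpa [hY] using hle

/-- A differentiable map with continuous derivative that vanishes at the origin is `O(t)` along
rays. -/
theorem exists_norm_le_mul_along_ray {E F : Type*} [NormedAddCommGroup E] [NormedSpace ℝ E]
    [NormedAddCommGroup F] [NormedSpace ℝ F] {Ω : Set E} (hΩ : IsOpen Ω)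
    (hstar : StarConvex ℝ 0 Ω) {f : E → F} (hf : ContDiffOn ℝ 1 f Ω) (h0 : f 0 = 0)
    {v : E} (hv : v ∈ Ω) : ∃ C : ℝ, ∀ t ∈ Icc (0 : ℝ) 1, ‖f (t • v)‖ ≤ C * t := by
  have hmem : ∀ t ∈ Icc (0 : ℝ) 1, t • v ∈ Ω := fun t ht => hstar.smul_mem hv ht.1 ht.2
  have hcont : ContinuousOn (fun t : ℝ => fderiv ℝ f (t • v) v) (Icc 0 1) :=
    ((hf.continuousOn_fderiv_of_isOpen hΩ le_rfl).comp (by fun_prop) hmem).clm_apply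
      continuousOn_const
  obtain ⟨C, hC⟩ := isCompact_Icc.exists_bound_of_continuousOn hcont
  refine ⟨C, fun t ht => ?_⟩
  have hd : ∀ s ∈ Icc (0 : ℝ) 1, HasDerivWithinAt (fun t : ℝ => f (t • v))
      (fderiv ℝ f (s • v) v) (Icc 0 1) s := by
    intro s hs
    have h1 : HasFDerivAt f (fderiv ℝ f (s • v)) (s • v) :=
      ((hf.differentiableOn one_ne_zero).differentiableAt (hΩ.mem_nhds (hmem s hs))).hasFDerivAt
    have h2 : HasDerivAt (fun s : ℝ => s • v) v s := by
      simpa using (hasDerivAt_id s).smul_const v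
    exact (h1.comp_hasDerivAt s h2).hasDerivWithinAt
  have := (convex_Icc (0 : ℝ) 1).norm_image_sub_le_of_norm_hasDerivWithin_le hd hC
    (left_mem_Icc.2 zero_le_one) ht
  simpa [h0, abs_of_nonneg ht.1] using this

/-! ### Functions on the manifold in charts -/

section Charts

variable {d : ℕ} {M : Type*} [TopologicalSpace M]

/-- The part of the chart image of `φ` that corresponds to `U`. -/
def chartImage (φ : OpenPartialHomeomorph M (Model d)) (U : Set M) : Set (Model d) :=
  φ.target ∩ φ.symm ⁻¹' U

theorem isOpen_chartImage (φ : OpenPartialHomeomorph M (Model d)) {U : Set M} (hU : IsOpen U) :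
    IsOpen (chartImage φ U) :=
  φ.isOpen_inter_preimage_symm hU

variable [ChartedSpace (Model d) M]

theorem chartAt_mem_chartImage {U : Set M} {y : M} (hy : y ∈ U) :
    chartAt (Model d) y y ∈ chartImage (chartAt (Model d) y) U :=
  ⟨mem_chart_target _ y, by
    rw [mem_preimage, (chartAt (Model d) y).left_inv (mem_chart_source _ y)]; exact hy⟩

theorem ContMDiffOn.contDiffOn_chartImage [IsManifold (𝓡 d) ∞ M] {F : Type*}
    [NormedAddCommGroup F] [NormedSpace ℝ F] {U : Set M} {u : M → F}
    (hu : ContMDiffOn (𝓡 d) 𝓘(ℝ, F) ∞ u U) {φ : OpenPartialHomeomorph M (Model d)}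
    (hφ : φ ∈ atlas (Model d) M) :
    ContDiffOn ℝ ∞ (fun a => u (φ.symm a)) (chartImage φ U) := by
  have h1 : ContMDiffOn (𝓡 d) (𝓡 d) ∞ φ.symm φ.target :=
    contMDiffOn_symm_of_mem_maximalAtlas (IsManifold.subset_maximalAtlas hφ)
  exact contMDiffOn_iff_contDiffOn.1 (hu.comp (h1.mono inter_subset_left) fun a ha => ha.2)

end Charts

/-! ### Partial derivatives -/

section PartialDerivatives

variable {d : ℕ} {F : Type*} [NormedAddCommGroup F] [NormedSpace ℝ F]

theorem pderiv_congr_of_eventuallyEq {f f' : Model d → F} {a : Model d} (h : f =ᶠ[𝓝 a] f')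
    (i : Fin d) : pderiv i f a = pderiv i f' a := by
  simp only [pderiv, h.fderiv_eq]

theorem pderiv_congr_on_isOpen {f f' : Model d → F} {S : Set (Model d)} (hS : IsOpen S)
    (h : EqOn f f' S) (i : Fin d) : EqOn (pderiv i f) (pderiv i f') S := fun _ ha =>
  pderiv_congr_of_eventuallyEq (h.eventuallyEq_of_mem (hS.mem_nhds ha)) i

theorem contDiffOn_pderiv {f : Model d → F} {S : Set (Model d)} (hS : IsOpen S)
    (hf : ContDiffOn ℝ ∞ f S) (i : Fin d) : ContDiffOn ℝ ∞ (pderiv i f) S :=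
  (hf.fderiv_of_isOpen hS (m := ∞) (by simp)).clm_apply contDiffOn_const

theorem contDiffOn_differentiableAt {f : Model d → F} {S : Set (Model d)} (hS : IsOpen S)
    (hf : ContDiffOn ℝ ∞ f S) {a : Model d} (ha : a ∈ S) : DifferentiableAt ℝ f a :=
  (hf.differentiableOn (by simp)).differentiableAt (hS.mem_nhds ha)

theorem pderiv_add {f f' : Model d → F} {a : Model d} (hf : DifferentiableAt ℝ f a)
    (hf' : DifferentiableAt ℝ f' a) (i : Fin d) :
    pderiv i (f + f') a = pderiv i f a + pderiv i f' a := by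
  simp only [pderiv, fderiv_add hf hf', add_apply]

theorem pderiv_smul {H : Model d → ℝ} {f : Model d → F} {a : Model d}
    (hH : DifferentiableAt ℝ H a) (hf : DifferentiableAt ℝ f a) (i : Fin d) :
    pderiv i (fun b => H b • f b) a = H a • pderiv i f a + pderiv i H a • f a := by
  simp [pderiv, fderiv_fun_smul hH hf]

theorem pderiv_pderiv_smul {H : Model d → ℝ} {f : Model d → F} {S : Set (Model d)}
    (hS : IsOpen S) (hH : ContDiffOn ℝ ∞ H S) (hf : ContDiffOn ℝ ∞ f S) {a : Model d}
    (ha : a ∈ S) (i j : Fin d) :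
    pderiv i (pderiv j fun b => H b • f b) a =
      H a • pderiv i (pderiv j f) a + pderiv i H a • pderiv j f a
        + (pderiv j H a • pderiv i f a + pderiv i (pderiv j H) a • f a) := by
  have h1 : EqOn (pderiv j fun b => H b • f b)
      (fun b => H b • pderiv j f b + pderiv j H b • f b) S := fun b hb =>
    pderiv_smul (contDiffOn_differentiableAt hS hH hb) (contDiffOn_differentiableAt hS hf hb) j
  have hH' := contDiffOn_differentiableAt hS hH ha
  have hf' := contDiffOn_differentiableAt hS hf ha
  have hjH := contDiffOn_differentiableAt hS (contDiffOn_pderiv hS hH j) ha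
  have hjf := contDiffOn_differentiableAt hS (contDiffOn_pderiv hS hf j) ha
  rw [pderiv_congr_on_isOpen hS h1 i ha]
  exact (pderiv_add (hH'.smul hjf) (hjH.smul hf') i).trans
    (congrArg₂ (· + ·) (pderiv_smul hH' hjf i) (pderiv_smul hjH hf' i))

end PartialDerivatives

/-- The contraction of a second order Leibniz rule with a symmetric matrix. -/
theorem sum_sum_symm_smul {ι F : Type*} [Fintype ι] [AddCommGroup F] [Module ℝ F]
    (m : ι → ι → ℝ) (hm : ∀ i j, m i j = m j i) (h : ℝ) (a : ι → ℝ) (c : ι → F)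
    (q : ι → ι → F) (p : ι → ι → ℝ) (f : F) :
    ∑ i, ∑ j, m i j • (h • q i j + a i • c j + (a j • c i + p i j • f)) =
      h • (∑ i, ∑ j, m i j • q i j) + (2 : ℝ) • (∑ i, ∑ j, (m i j * a j) • c i)
        + (∑ i, ∑ j, m i j * p i j) • f := by
  have hswap : ∑ i, ∑ j, (m i j * a i) • c j = ∑ i, ∑ j, (m i j * a j) • c i := by
    rw [Finset.sum_comm]
    refine Finset.sum_congr rfl fun i _ => Finset.sum_congr rfl fun j _ => ?_
    rw [hm]
  rw [two_smul]
  nth_rewrite 1 [← hswap]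
  simp only [Finset.smul_sum, Finset.sum_smul, ← Finset.sum_add_distrib]
  refine Finset.sum_congr rfl fun i _ => Finset.sum_congr rfl fun j _ => ?_
  module

namespace LorentzianMetric

variable {d : ℕ} {M : Type*} [TopologicalSpace M] [ChartedSpace (Model d) M]
  (g : LorentzianMetric d M)

theorem gram_symm (φ : OpenPartialHomeomorph M (Model d)) (a : Model d) (i j : Fin d) :
    g.gram φ a i j = g.gram φ a j i :=
  g.symm _ _ _

theorem gramInv_symm (φ : OpenPartialHomeomorph M (Model d)) (a : Model d) (i j : Fin d) :
    g.gramInv φ a i j = g.gramInv φ a j i := by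
  have h : (g.gram φ a).transpose = g.gram φ a := by
    ext i j
    exact g.gram_symm φ a j i
  have h2 : (g.gramInv φ a).transpose = g.gramInv φ a := by
    rw [gramInv, Matrix.transpose_nonsing_inv, h]
  exact (congrFun (congrFun h2 i) j).symm

end LorentzianMetric

/-! ### The commutator of a normally hyperbolic operator with a function -/

section Commutator

variable {d r : ℕ} {M : Type*} [TopologicalSpace M] [ChartedSpace (Model d) M]

theorem contDiffOn_endFiber_apply {F : Type*} [NormedAddCommGroup F] [NormedSpace ℝ F]
    {A : F → EndFiber r} {f : F → Fiber r} {S : Set F} {n : WithTop ℕ∞}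
    (hA : ContDiffOn ℝ n A S) (hf : ContDiffOn ℝ n f S) :
    ContDiffOn ℝ n (fun a => A a (f a)) S := by
  have h : ContDiff ℝ n (fun p : EndFiber r × Fiber r => p.1 p.2) :=
    (isBoundedBilinearMap_apply (𝕜 := ℂ) (E := Fiber r) (F := Fiber r)).contDiff.restrict_scalars ℝ
  exact h.comp_contDiffOn (hA.prodMk hf)

namespace BundleConnection

variable {U : Set M} (D : BundleConnection d r M U)

theorem contDiffOn_coordDeriv {φ : OpenPartialHomeomorph M (Model d)}
    (hφ : φ ∈ atlas (Model d) M) (hU : IsOpen U) {f : Model d → Fiber r}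
    (hf : ContDiffOn ℝ ∞ f (chartImage φ U)) (i : Fin d) :
    ContDiffOn ℝ ∞ (D.coordDeriv φ i f) (chartImage φ U) :=
  (contDiffOn_pderiv (isOpen_chartImage φ hU) hf i).add
    (contDiffOn_endFiber_apply (D.smooth φ hφ i) hf)

theorem coordDeriv_smul {φ : OpenPartialHomeomorph M (Model d)} {H : Model d → ℝ}
    {f : Model d → Fiber r} {a : Model d} (hH : DifferentiableAt ℝ H a)
    (hf : DifferentiableAt ℝ f a) (i : Fin d) :
    D.coordDeriv φ i (fun b => H b • f b) a = H a • D.coordDeriv φ i f a + pderiv i H a • f a := by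
  rw [coordDeriv, pderiv_smul hH hf, coordDeriv,
    ContinuousLinearMap.map_smul_of_tower]
  module

theorem coordDeriv_add {φ : OpenPartialHomeomorph M (Model d)} {f f' : Model d → Fiber r}
    {a : Model d} (hf : DifferentiableAt ℝ f a) (hf' : DifferentiableAt ℝ f' a) (i : Fin d) :
    D.coordDeriv φ i (f + f') a = D.coordDeriv φ i f a + D.coordDeriv φ i f' a := by
  rw [coordDeriv, pderiv_add hf hf', Pi.add_apply, map_add, add_add_add_comm]
  rfl

theorem coordDeriv_coordDeriv_smul {φ : OpenPartialHomeomorph M (Model d)}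
    (hφ : φ ∈ atlas (Model d) M) (hU : IsOpen U) {H : Model d → ℝ} {f : Model d → Fiber r}
    (hH : ContDiffOn ℝ ∞ H (chartImage φ U)) (hf : ContDiffOn ℝ ∞ f (chartImage φ U))
    {a : Model d} (ha : a ∈ chartImage φ U) (i j : Fin d) :
    D.coordDeriv φ i (D.coordDeriv φ j fun b => H b • f b) a =
      H a • D.coordDeriv φ i (D.coordDeriv φ j f) a + pderiv i H a • D.coordDeriv φ j f a
        + (pderiv j H a • D.coordDeriv φ i f a + pderiv i (pderiv j H) a • f a) := by
  have hS := isOpen_chartImage φ hU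
  have h1 : EqOn (D.coordDeriv φ j fun b => H b • f b)
      (fun b => H b • D.coordDeriv φ j f b + pderiv j H b • f b) (chartImage φ U) := fun b hb =>
    D.coordDeriv_smul (contDiffOn_differentiableAt hS hH hb)
      (contDiffOn_differentiableAt hS hf hb) j
  have hH' := contDiffOn_differentiableAt hS hH ha
  have hf' := contDiffOn_differentiableAt hS hf ha
  have hjH := contDiffOn_differentiableAt hS (contDiffOn_pderiv hS hH j) ha
  have hjf := contDiffOn_differentiableAt hS (D.contDiffOn_coordDeriv hφ hU hf j) ha
  have h2 := D.coordDeriv_smul (φ := φ) hH' hjf i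
  have h3 := D.coordDeriv_smul (φ := φ) hjH hf' i
  have h4 : D.coordDeriv φ i (D.coordDeriv φ j fun b => H b • f b) a =
      D.coordDeriv φ i ((fun b => H b • D.coordDeriv φ j f b) + fun b => pderiv j H b • f b) a := by
    exact congrArg₂ (· + ·) (pderiv_congr_on_isOpen hS h1 i ha)
      (congrArg (D.form (φ.symm a) (coordVec φ a i)) (h1 ha))
  rw [h4]
  exact (D.coordDeriv_add (hH'.smul hjf) (hjH.smul hf') i).trans (congrArg₂ (· + ·) h2 h3)

/-- Leibniz' rule: symmetry of g^ij merges the two mixed terms into a single gradient derivative,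
and the Christoffel terms split between the second derivatives of `u` and of `h`. -/
theorem dAlembert_smul [IsManifold (𝓡 d) ∞ M] (g : LorentzianMetric d M) (hU : IsOpen U)
    {h : M → ℝ} (hh : ContMDiffOn (𝓡 d) 𝓘(ℝ, ℝ) ∞ h U) {u : M → Fiber r}
    (hu : IsSmoothSection (d := d) U u) {y : M} (hy : y ∈ U) :
    D.dAlembert g (fun p => h p • u p) y =
      h y • D.dAlembert g u y - (2 : ℝ) • D.gradDeriv g h u y + g.dAlembert h y • u y := by
  have hφ : chartAt (Model d) y ∈ atlas (Model d) M := chart_mem_atlas _ y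
  have hS := isOpen_chartImage (chartAt (Model d) y) hU
  have ha : chartAt (Model d) y y ∈ chartImage (chartAt (Model d) y) U := chartAt_mem_chartImage hy
  have hyy : (chartAt (Model d) y).symm (chartAt (Model d) y y) = y :=
    (chartAt (Model d) y).left_inv (mem_chart_source _ y)
  have hH := hh.contDiffOn_chartImage hφ
  have hf := hu.contDiffOn_chartImage hφ
  simp only [dAlembert, gradDeriv, LorentzianMetric.dAlembert]
  generalize chartAt (Model d) y = φ at *
  have hHa := contDiffOn_differentiableAt hS hH ha
  have hfa := contDiffOn_differentiableAt hS hf ha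
  simp only [D.coordDeriv_coordDeriv_smul hφ hU hH hf ha, D.coordDeriv_smul hHa hfa]
  rw [hyy]
  have key := sum_sum_symm_smul (fun i j => g.gramInv φ (φ y) i j) (g.gramInv_symm φ (φ y))
    (h y) (fun i => pderiv i (fun a => h (φ.symm a)) (φ y))
    (fun i => D.coordDeriv φ i (fun a => u (φ.symm a)) (φ y))
    (fun i j => D.coordDeriv φ i (D.coordDeriv φ j fun a => u (φ.symm a)) (φ y)
      - ∑ k, g.christoffel φ k i j (φ y) • D.coordDeriv φ k (fun a => u (φ.symm a)) (φ y))
    (fun i j => pderiv i (pderiv j fun a => h (φ.symm a)) (φ y)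
      - ∑ k, g.christoffel φ k i j (φ y) * pderiv k (fun a => h (φ.symm a)) (φ y)) (u y)
  rw [smul_neg, neg_smul, ← sub_eq_add_neg, ← neg_add', ← neg_add', ← key]
  congr 1
  refine Finset.sum_congr rfl fun i _ => Finset.sum_congr rfl fun j _ => congrArg _ ?_
  have hk : ∑ k, g.christoffel φ k i j (φ y) •
      (h y • D.coordDeriv φ k (fun a => u (φ.symm a)) (φ y)
        + pderiv k (fun a => h (φ.symm a)) (φ y) • u y) =
      h y • ∑ k, g.christoffel φ k i j (φ y) • D.coordDeriv φ k (fun a => u (φ.symm a)) (φ y)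
      + (∑ k, g.christoffel φ k i j (φ y) * pderiv k (fun a => h (φ.symm a)) (φ y)) • u y := by
    simp only [smul_add, Finset.sum_add_distrib, Finset.smul_sum, Finset.sum_smul, mul_smul]
    congr 1
    exact Finset.sum_congr rfl fun k _ => smul_comm _ _ _
  rw [hk]
  module

end BundleConnection

end Commutator

/-! ### The operator `ρ_x` as a commutator -/

section Rho

variable {d r : ℕ} {M : Type*} [TopologicalSpace M] [ChartedSpace (Model d) M]

theorem IsSmoothSection.smul {U : Set M} {h : M → ℝ} (hh : ContMDiffOn (𝓡 d) 𝓘(ℝ, ℝ) ∞ h U)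
    {u : M → Fiber r} (hu : IsSmoothSection (d := d) U u) :
    IsSmoothSection (d := d) U fun p => h p • u p :=
  ContMDiffOn.smul hh hu

/-- `B` commutes with multiplication by Γ_x and drops out of the commutator. The right-hand side no
longer mentions the connection. -/
theorem rho_eq_commutator [IsManifold (𝓡 d) ∞ M] {g : LorentzianMetric d M} {U : Set M}
    (hU : IsOpen U) {P : (M → Fiber r) → M → Fiber r} {D : BundleConnection d r M U}
    (hD : IsInducedConnection g U P D) {x : M}
    (hΓ : ContMDiffOn (𝓡 d) 𝓘(ℝ, ℝ) ∞ (g.sqDist U x) U) {u : M → Fiber r}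
    (hu : IsSmoothSection (d := d) U u) {y : M} (hy : y ∈ U) :
    rho g U D x u y = (1 / 2 : ℝ) • (g.sqDist U x y • P u y
      - P (fun p => g.sqDist U x p • u p) y) + (d : ℝ) • u y := by
  obtain ⟨B, -, hB⟩ := hD
  rw [hB u hu y hy, hB _ (hu.smul hΓ) y hy, D.dAlembert_smul g hU hΓ hu hy,
    ContinuousLinearMap.map_smul_of_tower, rho]
  module

/-- The value of a normally hyperbolic operator on a smooth section depends only on the section
over `U`. -/
theorem IsNormallyHyperbolic.congr {g : LorentzianMetric d M} {U : Set M} (hU : IsOpen U)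
    {P : (M → Fiber r) → M → Fiber r} (hP : IsNormallyHyperbolic g U P) {u u' : M → Fiber r}
    (hu : IsSmoothSection (d := d) U u) (hu' : IsSmoothSection (d := d) U u')
    (h : EqOn u u' U) {y : M} (hy : y ∈ U) : P u y = P u' y := by
  obtain ⟨A, C, -, -, hAC⟩ := hP (chartAt (Model d) y) (chart_mem_atlas _ y)
  have ha : chartAt (Model d) y y ∈ chartImage (chartAt (Model d) y) U := chartAt_mem_chartImage hy
  have hyy : (chartAt (Model d) y).symm (chartAt (Model d) y y) = y :=
    (chartAt (Model d) y).left_inv (mem_chart_source _ y)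
  have h1 := hAC u hu _ ha
  have h2 := hAC u' hu' _ ha
  have hS := isOpen_chartImage (chartAt (Model d) y) hU
  have heq : EqOn (fun b => u ((chartAt (Model d) y).symm b))
      (fun b => u' ((chartAt (Model d) y).symm b)) (chartImage (chartAt (Model d) y) U) :=
    fun b hb => h hb.2
  simp only [fun i j => pderiv_congr_on_isOpen hS (pderiv_congr_on_isOpen hS heq j) i ha,
    fun i => pderiv_congr_on_isOpen hS heq i ha] at h1
  simp only [hyy] at h1 h2
  rw [h1, h2, h hy]

theorem IsSmoothSection.const (U : Set M) (ξ : Fiber r) :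
    IsSmoothSection (d := d) U fun _ => ξ :=
  contMDiffOn_const

theorem IsSmoothSection.const_smul_add {U : Set M} {u u' : M → Fiber r}
    (hu : IsSmoothSection (d := d) U u) (hu' : IsSmoothSection (d := d) U u') (c : ℂ) :
    IsSmoothSection (d := d) U fun p => c • u p + u' p := by
  have h1 : ContDiff ℝ ∞ (fun w : Fiber r => c • w) := contDiff_const_smul _
  exact (h1.contMDiff.comp_contMDiffOn hu).add hu'

theorem isSmoothSection_apply {U : Set M} {V : M → EndFiber r}
    (hV : ContMDiffOn (𝓡 d) 𝓘(ℝ, EndFiber r) ∞ V U) (ξ : Fiber r) :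
    IsSmoothSection (d := d) U fun p => V p ξ := by
  have h1 : ContDiff ℝ ∞ (fun A : EndFiber r => A ξ) :=
    ((ContinuousLinearMap.apply ℂ (Fiber r) ξ).contDiff (n := ∞)).restrict_scalars ℝ
  exact h1.contMDiff.comp_contMDiffOn hV

/-- `P` is a bare map on functions; its linearity over ℂ comes from the coordinate formula, and so
only for smooth sections at points of `U`. -/
theorem IsNormallyHyperbolic.map_const_smul_add [IsManifold (𝓡 d) ∞ M]
    {g : LorentzianMetric d M} {U : Set M} (hU : IsOpen U)
    {P : (M → Fiber r) → M → Fiber r} (hP : IsNormallyHyperbolic g U P) {u u' : M → Fiber r}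
    (hu : IsSmoothSection (d := d) U u) (hu' : IsSmoothSection (d := d) U u') (c : ℂ) {y : M}
    (hy : y ∈ U) : P (fun p => c • u p + u' p) y = c • P u y + P u' y := by
  have hφ := chart_mem_atlas (Model d) y
  have hS := isOpen_chartImage (chartAt (Model d) y) hU
  obtain ⟨A, C, -, -, hAC⟩ := hP (chartAt (Model d) y) hφ
  have ha : chartAt (Model d) y y ∈ chartImage (chartAt (Model d) y) U := chartAt_mem_chartImage hy
  have hyy : (chartAt (Model d) y).symm (chartAt (Model d) y y) = y :=
    (chartAt (Model d) y).left_inv (mem_chart_source _ y)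
  have h1 := hAC _ (hu.const_smul_add hu' c) _ ha
  have h2 := hAC _ hu _ ha
  have h3 := hAC _ hu' _ ha
  have hf := hu.contDiffOn_chartImage hφ
  have hf' := hu'.contDiffOn_chartImage hφ
  have hlin : ∀ (f f' : Model d → Fiber r),
      ContDiffOn ℝ ∞ f (chartImage (chartAt (Model d) y) U) →
      ContDiffOn ℝ ∞ f' (chartImage (chartAt (Model d) y) U) → ∀ i,
      EqOn (pderiv i fun b => c • f b + f' b) (fun b => c • pderiv i f b + pderiv i f' b)
        (chartImage (chartAt (Model d) y) U) := by
    intro f f' hf hf' i b hb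
    have h4 := contDiffOn_differentiableAt hS hf hb
    have h5 := contDiffOn_differentiableAt hS hf' hb
    simp only [pderiv]
    rw [fderiv_fun_add (h4.fun_const_smul c) h5, fderiv_fun_const_smul h4]
    rfl
  simp only [fun i j => (pderiv_congr_on_isOpen hS (hlin _ _ hf hf' j) i ha).trans
    (hlin _ _ (contDiffOn_pderiv hS hf j) (contDiffOn_pderiv hS hf' j) i ha),
    fun i => hlin _ _ hf hf' i ha] at h1
  simp only [hyy, map_add, map_smul, smul_add, Finset.sum_add_distrib] at h1 h2 h3
  rw [h1, h2, h3]
  simp only [smul_add, smul_neg, Finset.smul_sum]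
  simp only [smul_comm c (_ : ℝ)]
  abel

theorem rho_const_smul_add [IsManifold (𝓡 d) ∞ M] {g : LorentzianMetric d M} {U : Set M}
    (hU : IsOpen U) {P : (M → Fiber r) → M → Fiber r} (hP : IsNormallyHyperbolic g U P)
    {D : BundleConnection d r M U} (hD : IsInducedConnection g U P D) {x : M}
    (hΓ : ContMDiffOn (𝓡 d) 𝓘(ℝ, ℝ) ∞ (g.sqDist U x) U) {u u' : M → Fiber r}
    (hu : IsSmoothSection (d := d) U u) (hu' : IsSmoothSection (d := d) U u') (c : ℂ) {y : M}
    (hy : y ∈ U) :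
    rho g U D x (fun p => c • u p + u' p) y = c • rho g U D x u y + rho g U D x u' y := by
  have h1 : (fun p => g.sqDist U x p • (c • u p + u' p)) =
      fun p => c • (g.sqDist U x p • u p) + g.sqDist U x p • u' p := by
    funext p
    rw [smul_add, smul_comm]
  rw [rho_eq_commutator hU hD hΓ hu hy, rho_eq_commutator hU hD hΓ hu' hy,
    rho_eq_commutator hU hD hΓ (hu.const_smul_add hu' c) hy, h1,
    hP.map_const_smul_add hU (hu.smul hΓ) (hu'.smul hΓ) c hy,
    hP.map_const_smul_add hU hu hu' c hy]
  simp only [smul_add, smul_sub, smul_comm c (_ : ℝ)]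
  abel

theorem IsNormallyHyperbolic.shiftOp {g : LorentzianMetric d M} {U : Set M}
    {P : (M → Fiber r) → M → Fiber r} (hP : IsNormallyHyperbolic g U P) (z : ℂ) :
    IsNormallyHyperbolic g U (shiftOp P z) := by
  intro φ hφ
  obtain ⟨A, C, hA, hC, hAC⟩ := hP φ hφ
  refine ⟨A, fun a => C a - z • ContinuousLinearMap.id ℂ (Fiber r), hA, hC.sub contDiffOn_const,
    fun u hu a ha => ?_⟩
  have := hAC u hu a ha
  simp only [_root_.shiftOp, this]
  simp
  abel

/-- The shift is absorbed by replacing `B` with `B - z`, so ρ_x is the same operator for `P` and `P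
- z`. -/
theorem IsInducedConnection.shiftOp {g : LorentzianMetric d M} {U : Set M}
    {P : (M → Fiber r) → M → Fiber r} {D : BundleConnection d r M U}
    (hD : IsInducedConnection g U P D) (z : ℂ) :
    IsInducedConnection g U (shiftOp P z) D := by
  obtain ⟨B, hB, hPB⟩ := hD
  refine ⟨fun y => B y - z • ContinuousLinearMap.id ℂ (Fiber r), hB.sub contMDiffOn_const,
    fun u hu y hy => ?_⟩
  simp [_root_.shiftOp, hPB u hu y hy]
  abel

/-- The first order part of the commutator of a normally hyperbolic operator and a function, in
a chart. -/
theorem IsNormallyHyperbolic.exists_commutator_eq [IsManifold (𝓡 d) ∞ M]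
    {g : LorentzianMetric d M} {U : Set M} (hU : IsOpen U)
    {P : (M → Fiber r) → M → Fiber r} (hP : IsNormallyHyperbolic g U P)
    {φ : OpenPartialHomeomorph M (Model d)} (hφ : φ ∈ atlas (Model d) M)
    (hg : ∀ i j, ContDiffOn ℝ ∞ (fun a => g.gramInv φ a i j) φ.target)
    {h : M → ℝ} (hh : ContMDiffOn (𝓡 d) 𝓘(ℝ, ℝ) ∞ h U) :
    ∃ K : Model d → EndFiber r, ContDiffOn ℝ ∞ K (chartImage φ U) ∧
      ∀ u : M → Fiber r, IsSmoothSection (d := d) U u → ∀ a ∈ chartImage φ U,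
        (1 / 2 : ℝ) • (h (φ.symm a) • P u (φ.symm a) - P (fun p => h p • u p) (φ.symm a)) =
          ∑ i, ∑ j, (g.gramInv φ a i j * pderiv j (fun b => h (φ.symm b)) a) •
            pderiv i (fun b => u (φ.symm b)) a + K a (u (φ.symm a)) := by
  obtain ⟨A, C, hA, hC, hAC⟩ := hP φ hφ
  have hS := isOpen_chartImage φ hU
  have hH := hh.contDiffOn_chartImage hφ
  -- The zeroth order remainder: second derivatives of `h` from the principal part, first
  -- derivatives from the `A i`. The term `C` commutes with `h` and cancels.
  refine ⟨fun a => (1 / 2 : ℝ) • ((∑ i, ∑ j, g.gramInv φ a i j *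
      pderiv i (pderiv j fun b => h (φ.symm b)) a) • ContinuousLinearMap.id ℂ (Fiber r)
      - ∑ i, pderiv i (fun b => h (φ.symm b)) a • A i a), ?_, fun u hu a ha => ?_⟩
  · have h1 : ContDiffOn ℝ ∞ (fun a => ∑ i, ∑ j, g.gramInv φ a i j *
        pderiv i (pderiv j fun b => h (φ.symm b)) a) (chartImage φ U) :=
      ContDiffOn.sum fun i _ => ContDiffOn.sum fun j _ => ((hg i j).mono inter_subset_left).mul
        (contDiffOn_pderiv hS (contDiffOn_pderiv hS hH j) i)
    have h2 : ContDiffOn ℝ ∞ (fun a => ∑ i, pderiv i (fun b => h (φ.symm b)) a • A i a)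
        (chartImage φ U) :=
      ContDiffOn.sum fun i _ => (contDiffOn_pderiv hS hH i).smul (hA i)
    exact ((h1.smul contDiffOn_const).sub h2).const_smul _
  · have hf := hu.contDiffOn_chartImage hφ
    have h1 := hAC u hu a ha
    have h2 := hAC _ (hu.smul hh) a ha
    have hHa := contDiffOn_differentiableAt hS hH ha
    have hfa := contDiffOn_differentiableAt hS hf ha
    simp only [pderiv_pderiv_smul hS hH hf ha, pderiv_smul hHa hfa] at h2
    have key := sum_sum_symm_smul (fun i j => g.gramInv φ a i j) (g.gramInv_symm φ a)
      (h (φ.symm a)) (fun i => pderiv i (fun a => h (φ.symm a)) a)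
      (fun i => pderiv i (fun a => u (φ.symm a)) a)
      (fun i j => pderiv i (pderiv j fun a => u (φ.symm a)) a)
      (fun i j => pderiv i (pderiv j fun a => h (φ.symm a)) a) (u (φ.symm a))
    have hA' : ∑ i, A i a (h (φ.symm a) • pderiv i (fun b => u (φ.symm b)) a
        + pderiv i (fun b => h (φ.symm b)) a • u (φ.symm a)) =
        h (φ.symm a) • ∑ i, A i a (pderiv i (fun b => u (φ.symm b)) a)
        + ∑ i, pderiv i (fun b => h (φ.symm b)) a • A i a (u (φ.symm a)) := by
      simp only [map_add, ContinuousLinearMap.map_smul_of_tower, Finset.sum_add_distrib,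
        Finset.smul_sum]
    simp only [add_assoc] at key h2
    rw [h1, h2, key, hA', ContinuousLinearMap.map_smul_of_tower]
    simp only [smul_apply, sub_apply, sum_apply, ContinuousLinearMap.id_apply]
    module

end Rho

/-! ### Coordinate expansions, matrix inversion, and the contracted geodesic equation -/

section BilinearForms

variable {d : ℕ}

theorem EuclideanSpace.sum_smul_single (b : Model d) :
    b = ∑ i, b i • EuclideanSpace.single i (1 : ℝ) := by
  ext j
  simp [Finset.sum_apply, Pi.single_apply]

theorem ContinuousLinearMap.apply_eq_sum_single {F : Type*} [NormedAddCommGroup F]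
    [NormedSpace ℝ F] (T : Model d →L[ℝ] F) (b : Model d) :
    T b = ∑ i, b i • T (EuclideanSpace.single i 1) := by
  conv_lhs => rw [EuclideanSpace.sum_smul_single b]
  simp

theorem ContinuousLinearMap.apply_apply_eq_sum_single (B : Model d →L[ℝ] Model d →L[ℝ] ℝ)
    (b c : Model d) :
    B b c = ∑ i, ∑ j, B (EuclideanSpace.single i 1) (EuclideanSpace.single j 1) * b i * c j := by
  rw [B.apply_eq_sum_single b]
  simp only [sum_apply, smul_apply]
  refine Finset.sum_congr rfl fun i _ => ?_
  rw [(B (EuclideanSpace.single i 1)).apply_eq_sum_single c, Finset.smul_sum]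
  refine Finset.sum_congr rfl fun j _ => ?_
  simp only [smul_eq_mul]
  ring

theorem contDiffOn_matrix_det {n : ℕ} {E : Type*} [NormedAddCommGroup E] [NormedSpace ℝ E]
    {S : Set E} {A : E → Matrix (Fin n) (Fin n) ℝ}
    (hA : ∀ i j, ContDiffOn ℝ ∞ (fun a => A a i j) S) :
    ContDiffOn ℝ ∞ (fun a => (A a).det) S := by
  simp only [Matrix.det_apply']
  exact ContDiffOn.sum fun σ _ => contDiffOn_const.mul (contDiffOn_prod fun i _ => hA _ _)

/-- Cramer's rule: each entry is a quotient of determinants of matrices with smooth entries. -/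
theorem contDiffOn_matrix_inv {n : ℕ} {E : Type*} [NormedAddCommGroup E] [NormedSpace ℝ E]
    {S : Set E} {A : E → Matrix (Fin n) (Fin n) ℝ}
    (hA : ∀ i j, ContDiffOn ℝ ∞ (fun a => A a i j) S) (hdet : ∀ a ∈ S, (A a).det ≠ 0)
    (i j : Fin n) : ContDiffOn ℝ ∞ (fun a => (A a)⁻¹ i j) S := by
  simp only [Matrix.inv_def, Ring.inverse_eq_inv', Matrix.smul_apply, smul_eq_mul,
    Matrix.adjugate_apply]
  refine ((contDiffOn_matrix_det hA).inv hdet).mul (contDiffOn_matrix_det fun k l => ?_)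
  by_cases h : k = j
  · subst h
    simp only [Matrix.updateRow_self]
    exact contDiffOn_const
  · simp only [Matrix.updateRow_ne h]
    exact hA k l

/-- The geodesic equation, contracted with the metric, in the form needed for the Gauss lemma. -/
theorem geodesic_equation_contracted {ι : Type*} [Fintype ι] [DecidableEq ι] (A : Matrix ι ι ℝ)
    (hA : A.det ≠ 0) (hsymm : ∀ i j, A i j = A j i) (m : ι → ι → ι → ℝ)
    (α β q s : ι → ℝ)
    (hq : ∀ k, q k + ∑ i, ∑ j, ((1 / 2 : ℝ) * ∑ l, A⁻¹ k l * (m i j l + m j i l - m l i j))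
      * α i * α j = 0) :
    ∑ i, ∑ j, ((∑ k, m k i j * α k) * α i * β j + A i j * q i * β j + A i j * α i * s j) =
      (1 / 2 : ℝ) * ∑ i, ∑ j, ((∑ k, m k i j * β k) * α i * α j + A i j * s i * α j
        + A i j * α i * s j) := by
  -- The Christoffel symbols of the first kind on (α, α), for `m k i j` = ∂_k A_ij; lowering the
  -- index of the geodesic equation gives A q = -Q.
  set Q : ι → ℝ := fun l => ∑ i, ∑ j, (1 / 2 : ℝ) * (m i j l + m j i l - m l i j) * α i * α j
    with hQ
  have hq' : q = -(A⁻¹.mulVec Q) := by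
    funext k
    rw [eq_neg_of_add_eq_zero_left (hq k)]
    simp only [Pi.neg_apply, Matrix.mulVec, dotProduct, hQ, Finset.mul_sum, Finset.sum_mul]
    congr 1
    symm
    rw [Finset.sum_comm]
    refine Finset.sum_congr rfl fun i _ => ?_
    rw [Finset.sum_comm]
    refine Finset.sum_congr rfl fun j _ => Finset.sum_congr rfl fun l _ => ?_
    ring
  have hAq : ∀ j, ∑ i, A i j * q i = - Q j := by
    intro j
    have h1 : A.mulVec q = -Q := by
      rw [hq', Matrix.mulVec_neg, Matrix.mulVec_mulVec, Matrix.mul_nonsing_inv _ hA.isUnit,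
        Matrix.one_mulVec]
    have h2 := congrFun h1 j
    simp only [Matrix.mulVec, dotProduct, Pi.neg_apply] at h2
    rw [← h2]
    exact Finset.sum_congr rfl fun i _ => by rw [hsymm]
  have h1 : ∑ i, ∑ j, A i j * q i * β j = ∑ j, -Q j * β j := by
    rw [Finset.sum_comm]
    refine Finset.sum_congr rfl fun j _ => ?_
    rw [← hAq, Finset.sum_mul]
  have h2 : ∑ i, ∑ j, A i j * s i * α j = ∑ i, ∑ j, A i j * α i * s j := by
    rw [Finset.sum_comm]
    refine Finset.sum_congr rfl fun i _ => Finset.sum_congr rfl fun j _ => ?_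
    rw [hsymm]
    ring
  -- Pairing Q with β gives T1 - ½T2, so the q-term cancels T1 on the left and leaves ½T2; the `s`
  -- terms agree by symmetry of A.
  set T1 := ∑ i, ∑ j, ∑ k, m i j k * α i * α j * β k with hT1
  set T2 := ∑ i, ∑ j, ∑ k, m k i j * α i * α j * β k with hT2
  have h3 : ∑ i, ∑ j, (∑ k, m k i j * α k) * α i * β j = T1 := by
    simp only [Finset.sum_mul, hT1]
    symm
    rw [Finset.sum_comm]
    refine Finset.sum_congr rfl fun i _ => ?_
    rw [Finset.sum_comm]
  have h4 : ∑ i, ∑ j, (∑ k, m k i j * β k) * α i * α j = T2 := by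
    simp only [Finset.sum_mul, hT2]
    refine Finset.sum_congr rfl fun i _ => Finset.sum_congr rfl fun j _ =>
      Finset.sum_congr rfl fun k _ => ?_
    ring
  have h5 : ∑ j, -Q j * β j = - (T1 - (1 / 2 : ℝ) * T2) := by
    have hT1' : T1 = ∑ i, ∑ j, ∑ k, m j i k * α i * α j * β k := by
      rw [hT1, Finset.sum_comm]
      refine Finset.sum_congr rfl fun i _ => Finset.sum_congr rfl fun j _ =>
        Finset.sum_congr rfl fun k _ => ?_
      ring
    have h6 : ∑ j, -Q j * β j = - (1 / 2 : ℝ) * (T1 + T1 - T2) := by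
      nth_rewrite 2 [hT1']
      simp only [hT1, hT2, hQ, Finset.mul_sum, Finset.sum_mul, ← Finset.sum_neg_distrib,
        ← Finset.sum_add_distrib, ← Finset.sum_sub_distrib]
      rw [Finset.sum_comm]
      refine Finset.sum_congr rfl fun i _ => ?_
      rw [Finset.sum_comm]
      refine Finset.sum_congr rfl fun j _ => Finset.sum_congr rfl fun k _ => ?_
      ring
    rw [h6]
    ring
  simp only [Finset.sum_add_distrib, h1, h2, h3, h4, h5]
  ring

end BilinearForms

/-! ### The metric in charts and its pullback -/

namespace LorentzianMetric

variable {d : ℕ} {M : Type*} [TopologicalSpace M] [ChartedSpace (Model d) M]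
  (g : LorentzianMetric d M)

/-- The metric at `p` as a bilinear form on the model space. -/
def form (p : M) : Model d →L[ℝ] Model d →L[ℝ] ℝ :=
  g.val p

/-- The derivative of a map from the model space to `M` as an endomorphism of the model space. -/
def _root_.modelDeriv (e : Model d → M) (w : Model d) : Model d →L[ℝ] Model d :=
  mfderiv (𝓡 d) (𝓡 d) e w

/-- The pullback of the metric along a map from the model space to `M`. -/
def pullback (e : Model d → M) (w : Model d) : Model d →L[ℝ] Model d →L[ℝ] ℝ :=
  (g.form (e w)).bilinearComp (modelDeriv e w) (modelDeriv e w)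

theorem pullback_apply (e : Model d → M) (w b c : Model d) :
    g.pullback e w b c = g.form (e w) (modelDeriv e w b) (modelDeriv e w c) :=
  rfl

theorem pullback_symm (e : Model d → M) (w b c : Model d) :
    g.pullback e w b c = g.pullback e w c b :=
  g.symm _ _ _

theorem pullback_chart_symm (φ : OpenPartialHomeomorph M (Model d)) (a b c : Model d) :
    g.pullback φ.symm a b c = ∑ i, ∑ j, g.gram φ a i j * b i * c j :=
  (g.pullback φ.symm a).apply_apply_eq_sum_single b c

theorem contDiffOn_gram {φ : OpenPartialHomeomorph M (Model d)}
    (hφ : φ ∈ atlas (Model d) M) (i j : Fin d) :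
    ContDiffOn ℝ ∞ (fun a => g.gram φ a i j) φ.target :=
  g.smooth φ hφ i j

variable [IsManifold (𝓡 d) ∞ M]

/-- The chart differential carries a kernel vector of the Gram matrix to a nonzero vector orthogonal
to everything. Being orthogonal to the timelike vector of `signature` it has positive square, yet it
is orthogonal to itself. -/
theorem det_gram_ne_zero {φ : OpenPartialHomeomorph M (Model d)}
    (hφ : φ ∈ atlas (Model d) M) {a : Model d} (ha : a ∈ φ.target) : (g.gram φ a).det ≠ 0 := by
  have : IsManifold (𝓡 d) 1 M := IsManifold.of_le (n := ∞) (by simp)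
  intro hdet
  obtain ⟨v, hv, hMv⟩ := Matrix.exists_mulVec_eq_zero_iff.2 hdet
  have hmd := (mdifferentiable_of_mem_atlas (I := 𝓡 d) hφ).symm
  have hker : ∀ b : Model d, g.pullback φ.symm a b (WithLp.toLp 2 v) = 0 := by
    intro b
    rw [pullback_chart_symm]
    refine Finset.sum_eq_zero fun i _ => ?_
    have := congrFun hMv i
    simp only [Matrix.mulVec, dotProduct, Pi.zero_apply] at this
    calc ∑ j, g.gram φ a i j * b i * v j = b i * ∑ j, g.gram φ a i j * v j := by
          rw [Finset.mul_sum]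
          exact Finset.sum_congr rfl fun j _ => by ring
      _ = 0 := by rw [this, mul_zero]
  obtain ⟨τ, -, hτ⟩ := g.signature (φ.symm a)
  set T := hmd.mfderiv (x := a) ha with hT
  have hn : T (WithLp.toLp 2 v) ≠ 0 := by
    intro h
    have := (map_eq_zero_iff T T.injective).1 h
    exact hv (congrArg WithLp.ofLp this)
  have h1 : g.val (φ.symm a) τ (T (WithLp.toLp 2 v)) = 0 := by
    have := hker (T.symm τ)
    have h2 : T (T.symm τ) = τ := T.apply_symm_apply τ
    rw [← h2]
    exact this
  have h2 := hτ _ hn h1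
  have h3 : g.val (φ.symm a) (T (WithLp.toLp 2 v)) (T (WithLp.toLp 2 v)) = 0 := hker _
  exact h2.ne' h3

theorem contDiffOn_gramInv {φ : OpenPartialHomeomorph M (Model d)}
    (hφ : φ ∈ atlas (Model d) M) (i j : Fin d) :
    ContDiffOn ℝ ∞ (fun a => g.gramInv φ a i j) φ.target :=
  contDiffOn_matrix_inv (g.contDiffOn_gram hφ) (fun _ ha => g.det_gram_ne_zero hφ ha) i j

end LorentzianMetric

/-! ### The exponential map read in charts -/

namespace LorentzianMetric.IsExpDiffeo

variable {d : ℕ} {M : Type*} [TopologicalSpace M] [ChartedSpace (Model d) M]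
  {g : LorentzianMetric d M}
  {U : Set M} {x : M} {Ω : Set (Model d)} {e : Model d → M} {l : M → Model d}

theorem apply_zero (h : g.IsExpDiffeo U x Ω e l) : e 0 = x := by
  have h1 := h.velocity 0 h.zero_mem
  have h2 := congrArg Bundle.TotalSpace.proj h1
  simpa [tangentMap] using h2

/-- The part of `Ω` that `e` maps into the domain of the chart `φ`. -/
def _root_.chartDomain (Ω : Set (Model d)) (e : Model d → M)
    (φ : OpenPartialHomeomorph M (Model d)) : Set (Model d) :=
  Ω ∩ e ⁻¹' φ.source

theorem isOpen_chartDomain (h : g.IsExpDiffeo U x Ω e l)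
    (φ : OpenPartialHomeomorph M (Model d)) : IsOpen (chartDomain Ω e φ) :=
  h.smooth.continuousOn.isOpen_inter_preimage h.isOpen φ.open_source

theorem mdifferentiableAt (h : g.IsExpDiffeo U x Ω e l) {w : Model d} (hw : w ∈ Ω) :
    MDifferentiableAt (𝓡 d) (𝓡 d) e w :=
  ((h.smooth w hw).contMDiffAt (h.isOpen.mem_nhds hw)).mdifferentiableAt (by simp)

theorem modelDeriv_zero (h : g.IsExpDiffeo U x Ω e l) (v : Model d) : modelDeriv e 0 v = v := by
  have hΩ : ∀ v ∈ Ω, modelDeriv e 0 v = v := by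
    intro v hv
    have h1 := h.velocity v hv
    have h2 : MDifferentiableAt 𝓘(ℝ, ℝ) (𝓡 d) (fun t : ℝ => t • v) 0 :=
      (((hasDerivAt_id (0 : ℝ)).smul_const v).differentiableAt).mdifferentiableAt
    have h3 : MDifferentiableAt (𝓡 d) (𝓡 d) e ((0 : ℝ) • v) := by
      rw [zero_smul]; exact h.mdifferentiableAt h.zero_mem
    have h4 : mfderiv 𝓘(ℝ, ℝ) (𝓡 d) (e ∘ fun t : ℝ => t • v) 0 =
      (mfderiv (𝓡 d) (𝓡 d) e ((0 : ℝ) • v)).comp (mfderiv 𝓘(ℝ, ℝ) (𝓡 d) (fun t : ℝ => t • v) 0) :=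
      mfderiv_comp (0 : ℝ) h3 h2
    have h5 : mfderiv 𝓘(ℝ, ℝ) (𝓡 d) (fun t : ℝ => t • v) 0 (1 : ℝ) = v := by
      rw [mfderiv_eq_fderiv]
      have := ((hasDerivAt_id (0 : ℝ)).smul_const v).hasFDerivAt.fderiv
      simp only [id] at this
      rw [this]
      exact (one_smul ℝ _).trans (one_smul ℝ v)
    have h6 : HEq (mfderiv 𝓘(ℝ, ℝ) (𝓡 d) (fun t : ℝ => e (t • v)) 0 (1 : ℝ)) v := by
      have := (Bundle.TotalSpace.mk.injEq _ _ _ _).mp h1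
      exact this.2
    have h7 : mfderiv 𝓘(ℝ, ℝ) (𝓡 d) (fun t : ℝ => e (t • v)) 0 (1 : ℝ) = v := eq_of_heq h6
    have h8 := congrArg (fun L => L (1 : ℝ)) h4
    have h9 : modelDeriv e ((0 : ℝ) • v) v = v := by
      refine Eq.trans ?_ h7
      refine Eq.trans ?_ h8.symm
      exact (congrArg (modelDeriv e ((0 : ℝ) • v)) h5).symm
    rwa [zero_smul] at h9
  -- `velocity` speaks only of vectors in `Ω`; rescaling into this neighbourhood and linearity give
  -- all vectors.
  obtain ⟨c, hc, hcv⟩ : ∃ c : ℝ, c ≠ 0 ∧ c • v ∈ Ω := by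
    have h1 : Tendsto (fun c : ℝ => c • v) (𝓝[≠] 0) (𝓝 0) := by
      have : Tendsto (fun c : ℝ => c • v) (𝓝 0) (𝓝 ((0 : ℝ) • v)) := by
        apply Continuous.tendsto; fun_prop
      rw [zero_smul] at this
      exact this.mono_left nhdsWithin_le_nhds
    have h2 := (h1.eventually (h.isOpen.mem_nhds h.zero_mem)).and self_mem_nhdsWithin
    obtain ⟨c, hc1, hc2⟩ := h2.exists
    exact ⟨c, hc2, hc1⟩
  have h1 := hΩ _ hcv
  rw [map_smul] at h1
  exact smul_right_injective _ hc h1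

theorem pullback_zero (h : g.IsExpDiffeo U x Ω e l) : g.pullback e 0 = g.form x := by
  ext b c
  rw [pullback_apply, h.modelDeriv_zero, h.modelDeriv_zero, h.apply_zero]

variable [IsManifold (𝓡 d) ∞ M]

theorem contDiffOn_chart_comp (h : g.IsExpDiffeo U x Ω e l)
    {φ : OpenPartialHomeomorph M (Model d)} (hφ : φ ∈ atlas (Model d) M) :
    ContDiffOn ℝ ∞ (φ ∘ e) (chartDomain Ω e φ) := by
  have h1 : ContMDiffOn (𝓡 d) (𝓡 d) ∞ φ φ.source :=
    contMDiffOn_of_mem_maximalAtlas (IsManifold.subset_maximalAtlas hφ)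
  exact contMDiffOn_iff_contDiffOn.1
    (h1.comp (h.smooth.mono inter_subset_left) fun a ha => ha.2)

theorem modelDeriv_eq (h : g.IsExpDiffeo U x Ω e l)
    {φ : OpenPartialHomeomorph M (Model d)} (hφ : φ ∈ atlas (Model d) M) {w : Model d}
    (hw : w ∈ chartDomain Ω e φ) (b : Model d) :
    modelDeriv e w b = modelDeriv φ.symm (φ (e w)) (fderiv ℝ (φ ∘ e) w b) := by
  have : IsManifold (𝓡 d) 1 M := IsManifold.of_le (n := ∞) (by simp)
  have hS := h.isOpen_chartDomain φ
  have h1 : (φ.symm ∘ (φ ∘ e)) =ᶠ[𝓝 w] e := by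
    filter_upwards [hS.mem_nhds hw] with w' hw'
    exact φ.left_inv hw'.2
  have h2 : MDifferentiableAt (𝓡 d) (𝓡 d) (φ ∘ e) w :=
    (contDiffOn_differentiableAt hS (h.contDiffOn_chart_comp hφ) hw).mdifferentiableAt
  have h3 : MDifferentiableAt (𝓡 d) (𝓡 d) φ.symm ((φ ∘ e) w) :=
    (mdifferentiable_of_mem_atlas (I := 𝓡 d) hφ).mdifferentiableAt_symm (φ.map_source hw.2)
  have h4 := mfderiv_comp w h3 h2
  have h5 := h1.mfderiv_eq (I := 𝓡 d) (I' := 𝓡 d)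
  rw [mfderiv_eq_fderiv] at h4
  have h6 := congrArg (fun L : Model d →L[ℝ] Model d => L b) (h5.symm.trans h4)
  exact h6

theorem pullback_eq (h : g.IsExpDiffeo U x Ω e l)
    {φ : OpenPartialHomeomorph M (Model d)} (hφ : φ ∈ atlas (Model d) M) {w : Model d}
    (hw : w ∈ chartDomain Ω e φ) (b c : Model d) :
    g.pullback e w b c = ∑ i, ∑ j, g.gram φ (φ (e w)) i j * (fderiv ℝ (φ ∘ e) w b) i
      * (fderiv ℝ (φ ∘ e) w c) j := by
  rw [← pullback_chart_symm, pullback_apply, pullback_apply, h.modelDeriv_eq hφ hw,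
    h.modelDeriv_eq hφ hw, φ.left_inv hw.2]

end LorentzianMetric.IsExpDiffeo

/-! ### The Gauss lemma for the exponential map -/

namespace LorentzianMetric.IsExpDiffeo

variable {d : ℕ} {M : Type*} [TopologicalSpace M] [ChartedSpace (Model d) M]
  {g : LorentzianMetric d M} [IsManifold (𝓡 d) ∞ M]
  {U : Set M} {x : M} {Ω : Set (Model d)} {e : Model d → M} {l : M → Model d}

/-- A coordinate of a vector-valued function is differentiated coordinatewise. -/
theorem _root_.HasDerivAt.modelCoord {f : ℝ → Model d} {f' : Model d} {t : ℝ}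
    (h : HasDerivAt f f' t) (i : Fin d) : HasDerivAt (fun s => f s i) (f' i) t :=
  (EuclideanSpace.proj i : Model d →L[ℝ] ℝ).hasFDerivAt.comp_hasDerivAt t h

theorem contDiffOn_pullback (h : g.IsExpDiffeo U x Ω e l) :
    ContDiffOn ℝ ∞ (g.pullback e) Ω := by
  refine contDiffOn_clm_apply.2 fun b => contDiffOn_clm_apply.2 fun c => ?_
  intro w hw
  have hφ := chart_mem_atlas (Model d) (e w)
  set φ := chartAt (Model d) (e w) with hφdef
  have hS := h.isOpen_chartDomain φ
  have hwS : w ∈ chartDomain Ω e φ := ⟨hw, mem_chart_source _ _⟩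
  have hE := h.contDiffOn_chart_comp hφ
  have hE' : ContDiffOn ℝ ∞ (fderiv ℝ (φ ∘ e)) (chartDomain Ω e φ) :=
    hE.fderiv_of_isOpen hS (m := ∞) (by simp)
  have hcoord : ∀ (b : Model d) (i : Fin d),
      ContDiffOn ℝ ∞ (fun w => (fderiv ℝ (φ ∘ e) w b) i) (chartDomain Ω e φ) := fun b i =>
    (EuclideanSpace.proj i : Model d →L[ℝ] ℝ).contDiff.comp_contDiffOn
      (hE'.clm_apply contDiffOn_const)
  have hF : ContDiffOn ℝ ∞ (fun w => ∑ i, ∑ j, g.gram φ (φ (e w)) i j *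
      (fderiv ℝ (φ ∘ e) w b) i * (fderiv ℝ (φ ∘ e) w c) j) (chartDomain Ω e φ) :=
    ContDiffOn.sum fun i _ => ContDiffOn.sum fun j _ =>
      (((g.contDiffOn_gram hφ i j).comp hE fun w hw => φ.map_source hw.2).mul
        (hcoord b i)).mul (hcoord c j)
  have h1 : ContDiffOn ℝ ∞ (fun w => g.pullback e w b c) (chartDomain Ω e φ) :=
    hF.congr fun w hw => h.pullback_eq hφ hw b c
  exact (h1.contDiffAt (hS.mem_nhds hwS)).contDiffWithinAt

/-- The derivative of the pulled back metric, in a chart. -/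
theorem fderiv_pullback_apply (h : g.IsExpDiffeo U x Ω e l)
    {φ : OpenPartialHomeomorph M (Model d)} (hφ : φ ∈ atlas (Model d) M) {w : Model d}
    (hw : w ∈ chartDomain Ω e φ) (a b c : Model d) :
    fderiv ℝ (g.pullback e) w a b c = ∑ i, ∑ j,
      ((∑ k, pderiv k (fun p => g.gram φ p i j) (φ (e w)) * (fderiv ℝ (φ ∘ e) w a) k)
          * (fderiv ℝ (φ ∘ e) w b) i * (fderiv ℝ (φ ∘ e) w c) j
        + g.gram φ (φ (e w)) i j * (fderiv ℝ (fderiv ℝ (φ ∘ e)) w a b) i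
          * (fderiv ℝ (φ ∘ e) w c) j
        + g.gram φ (φ (e w)) i j * (fderiv ℝ (φ ∘ e) w b) i
          * (fderiv ℝ (fderiv ℝ (φ ∘ e)) w a c) j) := by
  have hS := h.isOpen_chartDomain φ
  have hE := h.contDiffOn_chart_comp hφ
  -- Both sides of `pullback_eq` are differentiated along this line, and the derivatives at 0 are
  -- compared.
  have hline : HasDerivAt (fun s : ℝ => w + s • a) a 0 := by
    have := ((hasDerivAt_id (0 : ℝ)).smul_const a).const_add w
    rwa [one_smul] at this
  have hw0 : w + (0 : ℝ) • a = w := by simp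
  have hEd : HasFDerivAt (φ ∘ e) (fderiv ℝ (φ ∘ e) w) (w + (0 : ℝ) • a) := by
    rw [hw0]; exact (contDiffOn_differentiableAt hS hE hw).hasFDerivAt
  have hE'd : HasFDerivAt (fderiv ℝ (φ ∘ e)) (fderiv ℝ (fderiv ℝ (φ ∘ e)) w)
      (w + (0 : ℝ) • a) := by
    rw [hw0]
    exact (contDiffOn_differentiableAt hS (hE.fderiv_of_isOpen hS (m := ∞) (by simp))
      hw).hasFDerivAt
  have hGd : HasFDerivAt (g.pullback e) (fderiv ℝ (g.pullback e) w) (w + (0 : ℝ) • a) := by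
    rw [hw0]
    exact (contDiffOn_differentiableAt h.isOpen h.contDiffOn_pullback hw.1).hasFDerivAt
  have hMd : ∀ i j, HasDerivAt (fun s : ℝ => g.gram φ (φ (e (w + s • a))) i j)
      (∑ k, pderiv k (fun p => g.gram φ p i j) (φ (e w)) * (fderiv ℝ (φ ∘ e) w a) k) 0 := by
    intro i j
    have h1 : HasFDerivAt (fun p => g.gram φ p i j)
        (fderiv ℝ (fun p => g.gram φ p i j) (φ (e w))) ((φ ∘ e) (w + (0 : ℝ) • a)) := by
      rw [hw0]
      exact (contDiffOn_differentiableAt φ.open_target (g.contDiffOn_gram hφ i j)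
        (φ.map_source hw.2)).hasFDerivAt
    have h2 := h1.comp_hasDerivAt (0 : ℝ) (hEd.comp_hasDerivAt (0 : ℝ) hline)
    rw [ContinuousLinearMap.apply_eq_sum_single] at h2
    refine h2.congr_deriv (Finset.sum_congr rfl fun k _ => ?_)
    rw [smul_eq_mul, mul_comm]
    rfl
  have hTd : ∀ (b : Model d) i, HasDerivAt (fun s : ℝ => (fderiv ℝ (φ ∘ e) (w + s • a) b) i)
      ((fderiv ℝ (fderiv ℝ (φ ∘ e)) w a b) i) 0 := by
    intro b i
    have h2 := (hE'd.clm_apply (hasFDerivAt_const b _)).comp_hasDerivAt (0 : ℝ) hline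
    simp at h2
    exact h2.modelCoord i
  have hL : HasDerivAt (fun s : ℝ => g.pullback e (w + s • a) b c)
      (fderiv ℝ (g.pullback e) w a b c) 0 := by
    have h2 := ((hGd.clm_apply (hasFDerivAt_const b _)).clm_apply
      (hasFDerivAt_const c _)).comp_hasDerivAt (0 : ℝ) hline
    simp at h2
    exact h2
  have hR := HasDerivAt.fun_sum (u := Finset.univ) fun i _ =>
    HasDerivAt.fun_sum (u := Finset.univ) fun j _ => ((hMd i j).fun_mul (hTd b i)).fun_mul (hTd c j)
  have hev : (fun s : ℝ => g.pullback e (w + s • a) b c) =ᶠ[𝓝 0] fun s : ℝ =>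
      ∑ i, ∑ j, g.gram φ (φ (e (w + s • a))) i j * (fderiv ℝ (φ ∘ e) (w + s • a) b) i
      * (fderiv ℝ (φ ∘ e) (w + s • a) c) j := by
    have h1 := hline.continuousAt.tendsto
    rw [hw0] at h1
    filter_upwards [h1.eventually (hS.mem_nhds hw)] with s hs
    exact h.pullback_eq hφ hs b c
  rw [(hL.congr_of_eventuallyEq hev.symm).unique hR]
  refine Finset.sum_congr rfl fun i _ => Finset.sum_congr rfl fun j _ => ?_
  simp only [zero_smul, add_zero]
  ring

/-- The geodesic equation of the ray at time 1 only, where the preferred chart is the one at `e v`.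
This suffices because `v` ranges over all of `Ω`. -/
theorem geodesic_equation (h : g.IsExpDiffeo U x Ω e l) {v : Model d} (hv : v ∈ Ω) (k : Fin d) :
    (fderiv ℝ (fderiv ℝ (chartAt (Model d) (e v) ∘ e)) v v v) k
      + ∑ i, ∑ j, g.christoffel (chartAt (Model d) (e v)) k i j (chartAt (Model d) (e v) (e v))
        * (fderiv ℝ (chartAt (Model d) (e v) ∘ e) v v) i
        * (fderiv ℝ (chartAt (Model d) (e v) ∘ e) v v) j = 0 := by
  have hgeo := (h.geodesic v hv).2 1 (by simpa using hv) k
  simp only [one_smul] at hgeo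
  have hφ := chart_mem_atlas (Model d) (e v)
  have hwS : v ∈ chartDomain Ω e (chartAt (Model d) (e v)) := ⟨hv, mem_chart_source _ _⟩
  generalize chartAt (Model d) (e v) = φ at *
  have hS := h.isOpen_chartDomain φ
  have hE := h.contDiffOn_chart_comp hφ
  have hray : ∀ t : ℝ, HasDerivAt (fun s : ℝ => s • v) v t := fun t => by
    have := (hasDerivAt_id t).smul_const v
    rwa [one_smul] at this
  have hd1 : ∀ t : ℝ, t • v ∈ chartDomain Ω e φ →
      HasDerivAt (fun τ : ℝ => φ (e (τ • v))) (fderiv ℝ (φ ∘ e) (t • v) v) t := fun t ht => by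
    have h1 := (contDiffOn_differentiableAt hS hE ht).hasFDerivAt
    exact h1.comp_hasDerivAt t (hray t)
  have hev : deriv (fun τ : ℝ => φ (e (τ • v))) =ᶠ[𝓝 1] fun t => fderiv ℝ (φ ∘ e) (t • v) v := by
    have h1 := (hray 1).continuousAt.tendsto
    rw [one_smul] at h1
    filter_upwards [h1.eventually (hS.mem_nhds hwS)] with t ht
    exact (hd1 t ht).deriv
  have hE'd : HasFDerivAt (fderiv ℝ (φ ∘ e)) (fderiv ℝ (fderiv ℝ (φ ∘ e)) v)
      ((1 : ℝ) • v) := by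
    rw [one_smul]
    exact (contDiffOn_differentiableAt hS (hE.fderiv_of_isOpen hS (m := ∞) (by simp))
      hwS).hasFDerivAt
  have hd2 : HasDerivAt (fun t : ℝ => fderiv ℝ (φ ∘ e) (t • v) v)
      (fderiv ℝ (fderiv ℝ (φ ∘ e)) v v v) 1 := by
    have h2 := (hE'd.clm_apply (hasFDerivAt_const v _)).comp_hasDerivAt (1 : ℝ) (hray 1)
    simp at h2
    exact h2
  rw [hev.deriv_eq, hd2.deriv, hev.eq_of_nhds, one_smul] at hgeo
  exact hgeo

/-- The Gauss lemma. -/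
theorem pullback_apply_self (h : g.IsExpDiffeo U x Ω e l) {v : Model d} (hv : v ∈ Ω)
    (b : Model d) : g.pullback e v v b = g.form x v b := by
  rw [← h.pullback_zero]
  refine gauss_lemma_of_geodesic_rays h.isOpen h.starConvex (g.pullback e)
    (h.contDiffOn_pullback.differentiableOn (by simp)) (fun w _ => g.pullback_symm e w)
    (fun v hv b => ?_) hv b
  have hgeo := h.geodesic_equation hv
  have hφ := chart_mem_atlas (Model d) (e v)
  have hwS : v ∈ chartDomain Ω e (chartAt (Model d) (e v)) := ⟨hv, mem_chart_source _ _⟩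
  generalize chartAt (Model d) (e v) = φ at *
  have hS := h.isOpen_chartDomain φ
  -- The derivatives along `v` and along `b` produce D²(v,b) and D²(b,v), which must be the same
  -- vector `s` in the contracted equation.
  have hsymm : IsSymmSndFDerivAt ℝ (φ ∘ e) v :=
    ((h.contDiffOn_chart_comp hφ).contDiffAt (hS.mem_nhds hwS)).isSymmSndFDerivAt (by
      rw [minSmoothness_of_isRCLikeNormedField]
      exact WithTop.coe_le_coe.2 (le_top : (2 : ℕ∞) ≤ ⊤))
  rw [h.fderiv_pullback_apply hφ hwS, h.fderiv_pullback_apply hφ hwS, hsymm b v]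
  exact geodesic_equation_contracted _ (g.det_gram_ne_zero hφ (φ.map_source hwS.2))
    (g.gram_symm φ _) (fun k i j => pderiv k (fun p => g.gram φ p i j) (φ (e v))) _ _ _ _ hgeo

end LorentzianMetric.IsExpDiffeo

/-! ### Radial form of ρ_x and uniqueness for the transport equations -/

section Transport

variable {d r : ℕ} {M : Type*} [TopologicalSpace M] [ChartedSpace (Model d) M]
  {g : LorentzianMetric d M} {U : Set M} {x : M}

/-- Γ_x is built from a chosen inverse, so `Ω` and `e` must be matched to that very choice. -/
theorem LorentzianMetric.IsGeodesicallyConvex.exists_isExpDiffeo_invExp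
    (hU : g.IsGeodesicallyConvex U) (hx : x ∈ U) :
    ∃ Ω e, g.IsExpDiffeo U x Ω e (g.invExp U x) := by
  obtain ⟨Ω, e, l, h⟩ := hU.2 x hx
  exact Classical.epsilon_spec (p := fun l => ∃ Ω e, g.IsExpDiffeo U x Ω e l) ⟨l, Ω, e, h⟩

variable {Ω : Set (Model d)} {e : Model d → M}

namespace LorentzianMetric.IsExpDiffeo

theorem contMDiffOn_sqDist (h : g.IsExpDiffeo U x Ω e (g.invExp U x)) :
    ContMDiffOn (𝓡 d) 𝓘(ℝ, ℝ) ∞ (g.sqDist U x) U := by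
  have h1 : ContDiff ℝ ∞ (fun w : Model d => - g.form x w w) := by fun_prop
  exact h1.contMDiff.comp_contMDiffOn h.smooth_inv

theorem map_mem_chartImage {l : M → Model d} (h : g.IsExpDiffeo U x Ω e l)
    {φ : OpenPartialHomeomorph M (Model d)} {v : Model d} (hv : v ∈ chartDomain Ω e φ) :
    φ (e v) ∈ chartImage φ U :=
  ⟨φ.map_source hv.2, by rw [mem_preimage, φ.left_inv hv.2]; exact h.mapsTo hv.1⟩

theorem contDiffOn_comp_of_isSmoothSection {l : M → Model d} (h : g.IsExpDiffeo U x Ω e l)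
    {u : M → Fiber r} (hu : IsSmoothSection (d := d) U u) : ContDiffOn ℝ ∞ (u ∘ e) Ω :=
  contMDiffOn_iff_contDiffOn.1 (hu.comp h.smooth h.mapsTo)

/-- Uniqueness of the solutions of the transport equations. -/
theorem eq_zero_of_transport (h : g.IsExpDiffeo U x Ω e (g.invExp U x))
    {D : BundleConnection d r M U} {K : Model d → EndFiber r} (hK : ContDiffOn ℝ ∞ K Ω)
    (hK0 : K 0 = 0)
    (hρ : ∀ u : M → Fiber r, IsSmoothSection (d := d) U u → ∀ w ∈ Ω,
      rho g U D x u (e w) = (-2 : ℝ) • fderiv ℝ (u ∘ e) w w + K w (u (e w)))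
    {k : ℕ} {u : M → Fiber r} (hu : IsSmoothSection (d := d) U u)
    (hut : ∀ y ∈ U, rho g U D x u y = (2 * (k : ℝ)) • u y) (hu0 : k = 0 → u x = 0)
    {y : M} (hy : y ∈ U) : u y = 0 := by
  set v := g.invExp U x y with hv
  have hvΩ : v ∈ Ω := h.mapsTo_inv hy
  have hev : e v = y := h.right_inv y hy
  -- K(0) = 0 supplies the factor t that compensates the degeneracy of the radial derivative at the
  -- origin.
  obtain ⟨C, hC⟩ := exists_norm_le_mul_along_ray h.isOpen h.starConvex
    (hK.of_le (by simp)) hK0 hvΩ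
  have hmem : ∀ t ∈ Icc (0 : ℝ) 1, t • v ∈ Ω := fun t ht =>
    h.starConvex.smul_mem hvΩ ht.1 ht.2
  have hue := h.contDiffOn_comp_of_isSmoothSection hu
  have key := eq_zero_of_singular_ode k (fun t : ℝ => u (e (t • v)))
    (fun t => fderiv ℝ (u ∘ e) (t • v) v)
    (fun t => (1 / 2 : ℝ) • K (t • v) (u (e (t • v)))) C ?_ ?_ ?_ ?_
  · simpa only [one_smul, hev] using key
  · intro t ht
    have h1 := (contDiffOn_differentiableAt h.isOpen hue (hmem t ht)).hasFDerivAt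
    have h2 := (hasDerivAt_id t).smul_const v
    rw [one_smul] at h2
    exact h1.comp_hasDerivAt t h2
  · intro t ht
    have h1 := hρ u hu (t • v) (hmem t ht)
    rw [hut _ (h.mapsTo (hmem t ht)), map_smul] at h1
    have h2 : t • fderiv ℝ (u ∘ e) (t • v) v = (1 / 2 : ℝ) •
        (K (t • v) (u (e (t • v))) - (2 * (k : ℝ)) • u (e (t • v))) := by
      rw [h1]
      module
    rw [h2]
    module
  · intro t ht
    rw [norm_smul]
    have h1 := (K (t • v)).le_opNorm (u (e (t • v)))
    have h2 := mul_le_mul_of_nonneg_right (hC t ht) (norm_nonneg (u (e (t • v))))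
    have h3 : ‖(1 / 2 : ℝ)‖ = 1 / 2 := by norm_num
    rw [h3]
    linarith [norm_nonneg (K (t • v) (u (e (t • v))))]
  · intro hk
    simpa only [zero_smul, h.apply_zero] using hu0 hk

variable [IsManifold (𝓡 d) ∞ M]

/-- The gradient of the squared distance is minus twice the radial vector field. -/
theorem sum_gramInv_mul_pderiv_sqDist (hU : IsOpen U)
    (h : g.IsExpDiffeo U x Ω e (g.invExp U x)) {φ : OpenPartialHomeomorph M (Model d)}
    (hφ : φ ∈ atlas (Model d) M) {v : Model d} (hv : v ∈ chartDomain Ω e φ) (i : Fin d) :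
    ∑ j, g.gramInv φ (φ (e v)) i j * pderiv j (fun b => g.sqDist U x (φ.symm b)) (φ (e v)) =
      -2 * (fderiv ℝ (φ ∘ e) v v) i := by
  have hS := h.isOpen_chartDomain φ
  have hI := isOpen_chartImage φ hU
  have ha := h.map_mem_chartImage hv
  have hE := (contDiffOn_differentiableAt hS (h.contDiffOn_chart_comp hφ) hv).hasFDerivAt
  have hH := (contDiffOn_differentiableAt hI (h.contMDiffOn_sqDist.contDiffOn_chartImage hφ)
    ha).hasFDerivAt
  have hL := (contDiffOn_differentiableAt hI
    (ContMDiffOn.contDiffOn_chartImage h.smooth_inv hφ) ha).hasFDerivAt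
  -- In normal coordinates Γ_x is the quadratic form -g_x(w,w).
  have hΓ : ∀ b, fderiv ℝ (fun b => g.sqDist U x (φ.symm b)) (φ (e v)) (fderiv ℝ (φ ∘ e) v b) =
      -2 * g.form x v b := by
    intro b
    have h1 : (fun w => g.sqDist U x (φ.symm ((φ ∘ e) w))) =ᶠ[𝓝 v]
        fun w => - g.form x (id w) (id w) := by
      filter_upwards [hS.mem_nhds hv] with w hw
      have h2 : φ.symm ((φ ∘ e) w) = e w := φ.left_inv hw.2
      rw [h2]
      change - g.form x (g.invExp U x (e w)) (g.invExp U x (e w)) = _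
      rw [h.left_inv w hw.1]
      rfl
    have h2 := HasFDerivAt.comp v hH hE
    have h3 := (((hasFDerivAt_const (g.form x) v).clm_apply (hasFDerivAt_id v)).clm_apply
      (hasFDerivAt_id v)).neg
    have h4 := congrArg (fun L => L b) (h2.unique (h3.congr_of_eventuallyEq h1))
    simp at h4
    rw [h4, show g.form x b v = g.form x v b from g.symm _ _ _]
    ring
  -- Every coordinate vector is the image of some `b`, so `hΓ` determines all partial derivatives.
  have hsurj : ∀ c, fderiv ℝ (φ ∘ e) v
      (fderiv ℝ (fun b => g.invExp U x (φ.symm b)) (φ (e v)) c) = c := by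
    intro c
    have h1 : (fun b => (φ ∘ e) (g.invExp U x (φ.symm b))) =ᶠ[𝓝 (φ (e v))] id := by
      filter_upwards [hI.mem_nhds ha] with b hb
      change φ (e (g.invExp U x (φ.symm b))) = b
      rw [h.right_inv _ hb.2, φ.right_inv hb.1]
    have hE' : HasFDerivAt (φ ∘ e) (fderiv ℝ (φ ∘ e) v) (g.invExp U x (φ.symm (φ (e v)))) := by
      rwa [φ.left_inv hv.2, h.left_inv v hv.1]
    have h2 := HasFDerivAt.comp (φ (e v)) hE' hL
    have h3 := h2.unique ((hasFDerivAt_id (φ (e v))).congr_of_eventuallyEq h1)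
    exact congrArg (fun L => L c) h3
  -- The Gauss lemma replaces g_x by the metric at `e v`, so that the inverse Gram matrix can cancel
  -- it.
  have hp : (fun j => pderiv j (fun b => g.sqDist U x (φ.symm b)) (φ (e v))) =
      (-2 : ℝ) • (g.gram φ (φ (e v))).mulVec (fun i => (fderiv ℝ (φ ∘ e) v v) i) := by
    funext j
    rw [pderiv, ← hsurj (EuclideanSpace.single j 1), hΓ, ← h.pullback_apply_self hv.1,
      h.pullback_eq hφ hv, hsurj]
    simp only [Pi.smul_apply, smul_eq_mul, Matrix.mulVec, dotProduct]
    congr 1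
    refine Finset.sum_congr rfl fun i _ => ?_
    simp [g.gram_symm φ _ i j]
  have h5 := congrArg (fun q => (g.gramInv φ (φ (e v))).mulVec q i) hp
  simp only [Matrix.mulVec_smul, gramInv, Matrix.mulVec_mulVec, Matrix.nonsing_inv_mul _
    (g.det_gram_ne_zero hφ (φ.map_source hv.2)).isUnit, Matrix.one_mulVec] at h5
  exact h5

/-- In a chart, the first order part of `ρ_x` is minus twice the radial derivative. -/
theorem exists_rho_eq_in_chart (hU : IsOpen U) (h : g.IsExpDiffeo U x Ω e (g.invExp U x))
    {P : (M → Fiber r) → M → Fiber r} (hP : IsNormallyHyperbolic g U P)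
    {D : BundleConnection d r M U} (hD : IsInducedConnection g U P D)
    {φ : OpenPartialHomeomorph M (Model d)} (hφ : φ ∈ atlas (Model d) M) :
    ∃ K : Model d → EndFiber r, ContDiffOn ℝ ∞ K (chartDomain Ω e φ) ∧
      ∀ u : M → Fiber r, IsSmoothSection (d := d) U u → ∀ w ∈ chartDomain Ω e φ,
        rho g U D x u (e w) = (-2 : ℝ) • fderiv ℝ (u ∘ e) w w + K w (u (e w)) := by
  obtain ⟨K, hK, hKu⟩ := hP.exists_commutator_eq hU hφ (g.contDiffOn_gramInv hφ)
    h.contMDiffOn_sqDist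
  have hS := h.isOpen_chartDomain φ
  have hI := isOpen_chartImage φ hU
  refine ⟨fun w => K (φ (e w)) + (d : ℝ) • ContinuousLinearMap.id ℂ (Fiber r),
    (hK.comp (h.contDiffOn_chart_comp hφ) fun w hw => h.map_mem_chartImage hw).add
      contDiffOn_const, fun u hu w hw => ?_⟩
  have ha := h.map_mem_chartImage hw
  have hE := (contDiffOn_differentiableAt hS (h.contDiffOn_chart_comp hφ) hw).hasFDerivAt
  have hf := (contDiffOn_differentiableAt hI (hu.contDiffOn_chartImage hφ) ha).hasFDerivAt
  have h1 := hKu u hu _ ha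
  have hww : φ.symm (φ (e w)) = e w := φ.left_inv hw.2
  rw [hww] at h1
  rw [rho_eq_commutator hU hD h.contMDiffOn_sqDist hu (h.mapsTo hw.1), h1]
  have h2 : fderiv ℝ (u ∘ e) w w = fderiv ℝ (fun b => u (φ.symm b)) (φ (e w))
      (fderiv ℝ (φ ∘ e) w w) := by
    have h3 : (fun b => u (φ.symm b)) ∘ (φ ∘ e) =ᶠ[𝓝 w] u ∘ e := by
      filter_upwards [hS.mem_nhds hw] with w' hw'
      exact congrArg u (φ.left_inv hw'.2)
    have h4 := (HasFDerivAt.comp w hf hE).congr_of_eventuallyEq h3.symm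
    rw [h4.fderiv]
    rfl
  rw [h2, ContinuousLinearMap.apply_eq_sum_single]
  simp only [← Finset.sum_smul, h.sum_gramInv_mul_pderiv_sqDist hU hφ hw]
  simp only [Finset.smul_sum, mul_smul, add_apply, smul_apply, ContinuousLinearMap.id_apply,
    pderiv, add_assoc]

/-- `ρ_x` is an ordinary differential operator along the radial geodesics. -/
theorem exists_rho_eq (hU : IsOpen U) (h : g.IsExpDiffeo U x Ω e (g.invExp U x))
    {P : (M → Fiber r) → M → Fiber r} (hP : IsNormallyHyperbolic g U P)
    {D : BundleConnection d r M U} (hD : IsInducedConnection g U P D) :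
    ∃ K : Model d → EndFiber r, ContDiffOn ℝ ∞ K Ω ∧
      ∀ u : M → Fiber r, IsSmoothSection (d := d) U u → ∀ w ∈ Ω,
        rho g U D x u (e w) = (-2 : ℝ) • fderiv ℝ (u ∘ e) w w + K w (u (e w)) := by
  choose K hK hKu using fun φ : atlas (Model d) M =>
    h.exists_rho_eq_in_chart hU hP hD φ.2
  set c : Model d → atlas (Model d) M := fun w => ⟨chartAt (Model d) (e w), chart_mem_atlas _ _⟩
    with hc
  have hmem : ∀ w ∈ Ω, w ∈ chartDomain Ω e (c w).1 := fun w hw => ⟨hw, mem_chart_source _ _⟩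
  refine ⟨fun w => K (c w) w, fun w₀ hw₀ => ?_, fun u hu w hw => hKu _ u hu w (hmem w hw)⟩
  have hS := h.isOpen_chartDomain (c w₀).1
  -- The chart of `c w` jumps with `w`, but the remainder does not: ρ_x applied to constant sections
  -- determines it.
  have h1 : (fun w => K (c w) w) =ᶠ[𝓝 w₀] K (c w₀) := by
    filter_upwards [hS.mem_nhds (hmem w₀ hw₀)] with w hw
    ext1 ξ
    have h2 := hKu (c w) (fun _ => ξ) (IsSmoothSection.const U ξ) w (hmem w hw.1)
    have h3 := hKu (c w₀) (fun _ => ξ) (IsSmoothSection.const U ξ) w hw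
    exact add_left_cancel (h2.symm.trans h3)
  exact (((hK (c w₀)).contDiffAt (hS.mem_nhds (hmem w₀ hw₀))).congr_of_eventuallyEq
    h1).contDiffWithinAt

end LorentzianMetric.IsExpDiffeo

end Transport

/-! ### Uniqueness of Hadamard families and the binomial formula -/

section Hadamard

variable {d r : ℕ} {M : Type*} [TopologicalSpace M] [ChartedSpace (Model d) M]
  {g : LorentzianMetric d M} {U : Set M} {x : M} {P : (M → Fiber r) → M → Fiber r}

/-- Additive maps on smooth sections commute with finite linear combinations. -/
theorem map_sum_smul_of_isSmoothSection {L : (M → Fiber r) → Fiber r}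
    (hL : ∀ (c : ℂ) (u u' : M → Fiber r), IsSmoothSection (d := d) U u →
      IsSmoothSection (d := d) U u' → L (fun p => c • u p + u' p) = c • L u + L u')
    {ι : Type*} (s : Finset ι) (c : ι → ℂ) (u : ι → M → Fiber r)
    (hu : ∀ i, IsSmoothSection (d := d) U (u i)) :
    IsSmoothSection (d := d) U (fun p => ∑ i ∈ s, c i • u i p) ∧
      L (fun p => ∑ i ∈ s, c i • u i p) = ∑ i ∈ s, c i • L (u i) := by
  classical
  induction s using Finset.induction_on with
  | empty =>
    have h0 : IsSmoothSection (d := d) U fun _ => (0 : Fiber r) := IsSmoothSection.const U 0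
    refine ⟨by simpa using h0, ?_⟩
    -- L 0 = L 0 + L 0 forces L 0 = 0.
    have h1 := hL 1 _ _ h0 h0
    simp only [smul_zero, add_zero, one_smul, right_eq_add] at h1
    simpa using h1
  | insert i s hi ih =>
    simp only [Finset.sum_insert hi]
    exact ⟨(hu i).const_smul_add ih.1 (c i), by rw [hL _ _ _ (hu i) ih.1, ih.2]⟩

variable [IsManifold (𝓡 d) ∞ M]

/-- Two Hadamard families may come with different connections; the commutator formula makes their
transport operators comparable. -/
theorem rho_congr (hU : IsOpen U) (hP : IsNormallyHyperbolic g U P)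
    {D D' : BundleConnection d r M U} (hD : IsInducedConnection g U P D)
    (hD' : IsInducedConnection g U P D')
    (hΓ : ContMDiffOn (𝓡 d) 𝓘(ℝ, ℝ) ∞ (g.sqDist U x) U) {u u' : M → Fiber r}
    (hu : IsSmoothSection (d := d) U u) (hu' : IsSmoothSection (d := d) U u')
    (h : EqOn u u' U) {y : M} (hy : y ∈ U) : rho g U D x u y = rho g U D' x u' y := by
  rw [rho_eq_commutator hU hD hΓ hu hy, rho_eq_commutator hU hD' hΓ hu' hy, h hy,
    hP.congr hU hu hu' h hy, hP.congr hU (hu.smul hΓ) (hu'.smul hΓ)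
      (fun p hp => congrArg (g.sqDist U x p • ·) (h hp)) hy]

/-- A normally hyperbolic operator has at most one family of Hadamard coefficients. -/
theorem IsHadamardFamily.eqOn (hU : g.IsGeodesicallyConvex U) (hP : IsNormallyHyperbolic g U P)
    (hx : x ∈ U) {V W : ℕ → M → EndFiber r} (hV : IsHadamardFamily g U P x V)
    (hW : IsHadamardFamily g U P x W) (k : ℕ) : EqOn (V k) (W k) U := by
  obtain ⟨Ω, e, h⟩ := hU.exists_isExpDiffeo_invExp hx
  obtain ⟨D, hD, hVs, hVx, hV0, hVk⟩ := hV
  obtain ⟨D', hD', hWs, hWx, hW0, hWk⟩ := hW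
  have hΓ := h.contMDiffOn_sqDist
  obtain ⟨K, hK, hρ⟩ := h.exists_rho_eq hU.1 hP hD
  -- At the origin the radial derivative drops out, so the equation for V⁰ with V⁰(x) = 1 reads
  -- K(0)ξ = 0. This avoids computing □Γ_x at x.
  have hK0 : K 0 = 0 := by
    ext1 ξ
    have h1 := hρ _ (isSmoothSection_apply (hVs 0) ξ) 0 h.zero_mem
    rw [hV0 ξ _ (h.mapsTo h.zero_mem), map_zero, smul_zero, zero_add, h.apply_zero, hVx] at h1
    exact h1.symm
  have hsec : ∀ k ξ, IsSmoothSection (d := d) U fun p => (-1 : ℂ) • W k p ξ + V k p ξ :=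
    fun k ξ => (isSmoothSection_apply (hWs k) ξ).const_smul_add (isSmoothSection_apply (hVs k) ξ) _
  have hdiff : ∀ k ξ, ∀ y ∈ U, rho g U D x (fun p => (-1 : ℂ) • W k p ξ + V k p ξ) y =
      (-1 : ℂ) • rho g U D' x (fun p => W k p ξ) y + rho g U D x (fun p => V k p ξ) y := by
    intro k ξ y hy
    rw [rho_const_smul_add hU.1 hP hD hΓ (isSmoothSection_apply (hWs k) ξ)
      (isSmoothSection_apply (hVs k) ξ) _ hy,
      rho_congr hU.1 hP hD hD' hΓ (isSmoothSection_apply (hWs k) ξ)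
        (isSmoothSection_apply (hWs k) ξ) (fun _ _ => rfl) hy]
  suffices hz : ∀ ξ, ∀ y ∈ U, (-1 : ℂ) • W k y ξ + V k y ξ = 0 by
    intro y hy
    ext1 ξ
    have := hz ξ y hy
    rwa [neg_one_smul, neg_add_eq_zero, eq_comm] at this
  induction k with
  | zero =>
    intro ξ y hy
    refine h.eq_zero_of_transport hK hK0 hρ (k := 0) (hsec 0 ξ) (fun y hy => ?_) (fun _ => ?_) hy
    · rw [hdiff 0 ξ y hy, hW0 ξ y hy, hV0 ξ y hy]
      simp
    · simp [hVx, hWx]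
  | succ k ih =>
    intro ξ y hy
    refine h.eq_zero_of_transport hK hK0 hρ (k := k + 1) (hsec (k + 1) ξ) (fun y hy => ?_)
      (fun hk => absurd hk k.succ_ne_zero) hy
    -- By induction the right-hand sides agree, so the difference solves the homogeneous equation;
    -- for positive index no initial value is needed.
    have hPeq : P (fun p => V k p ξ) y = P (fun p => W k p ξ) y :=
      hP.congr hU.1 (isSmoothSection_apply (hVs k) ξ) (isSmoothSection_apply (hWs k) ξ)
        (fun p hp => by
          have := ih ξ p hp
          rwa [neg_one_smul, neg_add_eq_zero, eq_comm] at this) hy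
    have h1 := hVk k ξ y hy
    have h2 := hWk k ξ y hy
    rw [hPeq, ← h2, sub_eq_sub_iff_add_eq_add] at h1
    have h3 : (2 * ((k + 1 : ℕ) : ℝ)) • ((-1 : ℂ) • W (k + 1) y ξ + V (k + 1) y ξ) =
        (2 * ((k : ℂ) + 1)) • ((-1 : ℂ) • W (k + 1) y ξ + V (k + 1) y ξ) := by
      rw [← Complex.coe_smul]
      push_cast
      rfl
    rw [hdiff (k + 1) ξ y hy, h3, eq_sub_of_add_eq h1]
    module

/-- The algebra of the theorem, with `a`, `p`, `ρ` standing for V^j, P V^j and ρ_x V^j at a point.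
-/
theorem sum_choose_transport {F : Type*} [AddCommGroup F] [Module ℂ F] (z : ℂ) (a p ρ : ℕ → F)
    (h0 : ρ 0 = 0) (hρ : ∀ k : ℕ, ρ (k + 1) - (2 * ((k : ℂ) + 1)) • a (k + 1) =
      (2 * ((k : ℂ) + 1)) • p k) (k : ℕ) :
    ∑ m ∈ Finset.range (k + 2), (((k + 1).choose m : ℂ) * z ^ m) • ρ (k + 1 - m)
      - (2 * ((k : ℂ) + 1)) •
        ∑ m ∈ Finset.range (k + 2), (((k + 1).choose m : ℂ) * z ^ m) • a (k + 1 - m) =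
      (2 * ((k : ℂ) + 1)) • (∑ m ∈ Finset.range (k + 1), ((k.choose m : ℂ) * z ^ m) • p (k - m)
        - z • ∑ m ∈ Finset.range (k + 1), ((k.choose m : ℂ) * z ^ m) • a (k - m)) := by
  have hpascal : ∑ m ∈ Finset.range (k + 2), (((k + 1).choose m : ℂ) * z ^ m) • a (k + 1 - m) =
      ∑ m ∈ Finset.range (k + 1), ((k.choose m : ℂ) * z ^ m) • a (k + 1 - m)
      + z • ∑ m ∈ Finset.range (k + 1), ((k.choose m : ℂ) * z ^ m) • a (k - m) := by
    have h1 := Finset.sum_choose_succ_nsmul (fun i j => z ^ i • a j) k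
    simp only [← Nat.cast_smul_eq_nsmul ℂ, smul_smul] at h1
    rw [h1, Finset.smul_sum]
    congr 1
    refine Finset.sum_congr rfl fun m _ => ?_
    rw [smul_smul]
    congr 1
    ring
  have hsum : ∑ m ∈ Finset.range (k + 2), (((k + 1).choose m : ℂ) * z ^ m) • ρ (k + 1 - m) =
      (2 * ((k : ℂ) + 1)) • (∑ m ∈ Finset.range (k + 1), ((k.choose m : ℂ) * z ^ m) • p (k - m)
        + ∑ m ∈ Finset.range (k + 1), ((k.choose m : ℂ) * z ^ m) • a (k + 1 - m)) := by
    -- The top index m = k+1 meets ρ 0 = 0; for the others k - m is a true difference and the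
    -- transport equation applies.
    rw [Finset.sum_range_succ, Nat.sub_self, h0, smul_zero, add_zero, ← Finset.sum_add_distrib,
      Finset.smul_sum]
    refine Finset.sum_congr rfl fun m hm => ?_
    have hmk : m ≤ k := Nat.lt_succ_iff.1 (Finset.mem_range.1 hm)
    have h1 := eq_add_of_sub_eq (hρ (k - m))
    have h2 : k - m + 1 = k + 1 - m := by omega
    have h3 : ((k - m : ℕ) : ℂ) + 1 = ((k + 1 - m : ℕ) : ℂ) := by exact_mod_cast h2
    rw [h2, h3] at h1
    have h4 : ((k.choose m : ℂ)) * (k + 1) = ((k + 1).choose m : ℂ) * ((k + 1 - m : ℕ) : ℂ) := by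
      exact_mod_cast Nat.choose_mul_succ_eq k m
    rw [h1, ← smul_add, ← smul_add, smul_smul, smul_smul]
    congr 1
    linear_combination (-2 * z ^ m) * h4
  rw [hsum, hpascal]
  module

/-- The binomial combinations of the Hadamard coefficients of `P` are Hadamard coefficients of
`P - z`. -/
theorem IsHadamardFamily.shiftOp (hU : g.IsGeodesicallyConvex U) (hP : IsNormallyHyperbolic g U P)
    (hx : x ∈ U) {V : ℕ → M → EndFiber r} (hV : IsHadamardFamily g U P x V) (z : ℂ)
    {W : ℕ → M → EndFiber r} (hW : ∀ k : ℕ, ∀ y ∈ U,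
      W k y = ∑ m ∈ Finset.range (k + 1), ((k.choose m : ℂ) * z ^ m) • V (k - m) y) :
    IsHadamardFamily g U (shiftOp P z) x W := by
  obtain ⟨Ω, e, h⟩ := hU.exists_isExpDiffeo_invExp hx
  obtain ⟨D, hD, hVs, hVx, hV0, hVk⟩ := hV
  have hΓ := h.contMDiffOn_sqDist
  have hWs : ∀ k, ContMDiffOn (𝓡 d) 𝓘(ℝ, EndFiber r) ∞ (W k) U := by
    intro k
    refine ContMDiffOn.congr (contMDiffOn_finsetSum fun m _ => ?_) (hW k)
    have h1 : ContDiff ℝ ∞ (fun A : EndFiber r => ((k.choose m : ℂ) * z ^ m) • A) :=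
      contDiff_const_smul _
    exact h1.contMDiff.comp_contMDiffOn (hVs (k - m))
  have hVsec := fun k ξ => isSmoothSection_apply (hVs k) ξ
  have hWsec := fun k ξ => isSmoothSection_apply (hWs k) ξ
  -- `W` is prescribed on `U` only, so ρ_x and `P` are evaluated on it through locality.
  have hWξ : ∀ k ξ, EqOn (fun p => W k p ξ) (fun p => ∑ m ∈ Finset.range (k + 1),
      ((k.choose m : ℂ) * z ^ m) • V (k - m) p ξ) U := by
    intro k ξ p hp
    simp [hW k p hp, sum_apply]
  have hρW : ∀ k ξ, ∀ y ∈ U, rho g U D x (fun p => W k p ξ) y = ∑ m ∈ Finset.range (k + 1),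
      ((k.choose m : ℂ) * z ^ m) • rho g U D x (fun p => V (k - m) p ξ) y := by
    intro k ξ y hy
    obtain ⟨h1, h2⟩ := map_sum_smul_of_isSmoothSection (U := U) (L := fun u => rho g U D x u y)
      (fun c u u' hu hu' => rho_const_smul_add hU.1 hP hD hΓ hu hu' c hy)
      (Finset.range (k + 1)) (fun m => (k.choose m : ℂ) * z ^ m) (fun m p => V (k - m) p ξ)
      (fun m => hVsec _ ξ)
    rw [rho_congr hU.1 hP hD hD hΓ (hWsec k ξ) h1 (hWξ k ξ) hy]
    exact h2
  have hPW : ∀ k ξ, ∀ y ∈ U, P (fun p => W k p ξ) y = ∑ m ∈ Finset.range (k + 1),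
      ((k.choose m : ℂ) * z ^ m) • P (fun p => V (k - m) p ξ) y := by
    intro k ξ y hy
    obtain ⟨h1, h2⟩ := map_sum_smul_of_isSmoothSection (U := U) (L := fun u => P u y)
      (fun c u u' hu hu' => hP.map_const_smul_add hU.1 hu hu' c hy)
      (Finset.range (k + 1)) (fun m => (k.choose m : ℂ) * z ^ m) (fun m p => V (k - m) p ξ)
      (fun m => hVsec _ ξ)
    rw [hP.congr hU.1 (hWsec k ξ) h1 (hWξ k ξ) hy]
    exact h2
  refine ⟨D, hD.shiftOp z, hWs, ?_, fun ξ y hy => ?_, fun k ξ y hy => ?_⟩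
  · simp [hW 0 x hx, hVx]
  · simp [hρW 0 ξ y hy, hV0 ξ y hy]
  · simp only [_root_.shiftOp]
    rw [hρW (k + 1) ξ y hy, hPW k ξ y hy]
    have h1 := hWξ (k + 1) ξ hy
    have h2 := hWξ k ξ hy
    simp only at h1 h2
    rw [h1, h2]
    exact sum_choose_transport z (fun j => V j y ξ) (fun j => P (fun p => V j p ξ) y)
      (fun j => rho g U D x (fun p => V j p ξ) y) (hV0 ξ y hy) (fun j => hVk j ξ y hy) k

end Hadamard

end

theorem proposition4p2 {d r : ℕ} (hd : 2 ≤ d) {M : Type*} [TopologicalSpace M] [T2Space M]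
    [SecondCountableTopology M] [ChartedSpace (Model d) M] [IsManifold (𝓡 d) ∞ M]
    (g : LorentzianMetric d M) (U : Set M) (hU : g.IsGeodesicallyConvex U)
    (P : (M → Fiber r) → M → Fiber r) (hP : IsNormallyHyperbolic g U P)
    (x : M) (hx : x ∈ U) (V : ℕ → M → EndFiber r) (hV : IsHadamardFamily g U P x V)
    (z : ℂ) (W : ℕ → M → EndFiber r) :
    IsHadamardFamily g U (shiftOp P z) x W ↔
      ∀ k : ℕ, ∀ y ∈ U,
        W k y = ∑ m ∈ Finset.range (k + 1), ((k.choose m : ℂ) * z ^ m) • V (k - m) y := by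
  refine ⟨fun hW k y hy => ?_, fun hW => hV.shiftOp hU hP hx z hW⟩
  -- The explicit binomial family is itself Hadamard for `P - z`; uniqueness for that operator
  -- identifies it with `W`.
  exact hW.eqOn hU (hP.shiftOp z) hx (hV.shiftOp hU hP hx z fun _ _ _ => rfl) k hy
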